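/- Let $\nu$ be a positive finite Borel measure on $(0,1)$ with $1\in\operatorname{supp}\nu$ (that is, $\nu((1-\varepsilon,1))>0$ for every $\varepsilon>0$). Let $m$ be normalized Lebesgue measure on the unit circle $\mathbb T$, and let $\mu$ be the measure on the open unit disc $\mathbb D$ given by $d\mu(r\zeta)=dm(\zeta)\,d\nu(r)$, $r\in(0,1)$, $\zeta\in\mathbb T$. Put $\chi(z)=z$ for $z\in\mathbb D$, let $\overline{P^2(\mathbb D,\mu)}$ be the closed linear span of the functions $\overline{\chi}^{\,n}$, $n\ge 0$, in $L^2(\mathbb D,\mu)$, let $$\overline{L^2_a(\mathbb D,\mu)}=\{f\in L^2(\mathbb D,\mu): \overline f\text{ is analytic in }\mathbb D\},$$ and let $\mathcal H=L^2(\mathbb D,\mu)\ominus\overline{P^2(\mathbb D,\mu)}$. The space $\mathcal H$ is invariant under multiplication by $\chi$; let $T$ be the operator of multiplication by $\chi$ acting on $\mathcal H$. Then: 1. $\overline{P^2(\mathbb D,\mu)}=\overline{L^2_a(\mathbb D,\mu)}$. 2. $T$ is a contraction ($\|T\|\le 1$); $T$ is subnormal, i.e. it is the restriction of a normal operator on a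 Hilbert space containing $\mathcal H$ to the invariant subspace $\mathcal H$; and $T$ is pure, i.e. there is no nonzero closed subspace $\mathcal M$ of $\mathcal H$, invariant under both $T$ and $T^*$, such that $T|_{\mathcal M}$ is normal. 3. There is a sequence $(\mathcal M_n)_{n\ge 1}$ of closed $T$-invariant subspaces of $\mathcal H$ whose closed linear span is $\mathcal H$ and such that $\sigma(T|_{\mathcal M_n})\subset\mathbb D$ for every $n$. 4. $\mathbb T\subset\sigma(T)$. 5. For every $\xi\in\mathbb T$ the operators $T$ and $\xi T$ are unitarily equivalent. 6. If, in addition, $\displaystyle\int_{(0,1)}\frac{d\nu(r)}{|r^2-a^2|}=\infty$ for every $a\in[0,1)$ (with the convention $1/0=\infty$), then the point spectrum of $T^*$ is empty: $\sigma_{\mathrm p}(T^*)=\emptyset$. -/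

import Mathlib

open MeasureTheory Set
open scoped ENNReal ComplexConjugate

noncomputable section

/-- The open unit disc. -/
abbrev Disc : Type := Metric.ball (0 : ℂ) 1

section Operators

universe u v

variable {H : Type u} [NormedAddCommGroup H] [InnerProductSpace ℂ H]
variable {K : Type v} [NormedAddCommGroup K] [InnerProductSpace ℂ K]

/-- Subnormality: `T` is, up to an isometric identification `V` of `H` with a subspace of a
Hilbert space, the restriction of a normal operator to an invariant subspace. -/
def IsSubnormal (T : H →L[ℂ] H) : Prop :=
  ∃ (K : Type u) (_ : NormedAddCommGroup K) (_ : InnerProductSpace ℂ K) (_ : CompleteSpace K)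
    (N : K →L[ℂ] K) (V : H →ₗᵢ[ℂ] K), IsStarNormal N ∧ ∀ x : H, N (V x) = V (T x)

/-- Purity: no nonzero closed subspace (equivalently, complete subspace) that is invariant under
`T` and its adjoint carries a normal restriction of `T`. -/
def IsPure [CompleteSpace H] (T : H →L[ℂ] H) : Prop :=
  ∀ (M : Submodule ℂ H) [CompleteSpace M] (hT : ∀ x ∈ M, T x ∈ M),
    (∀ x ∈ M, ContinuousLinearMap.adjoint T x ∈ M) → IsStarNormal (T.restrict hT) → M = ⊥

/-- `T` is a contraction having a sequence of closed invariant subspaces whose closed linear span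
is the whole space and such that each restriction has its spectrum inside the open unit disc. -/
def HasDiscSpectrumExhaustion (T : H →L[ℂ] H) : Prop :=
  ‖T‖ ≤ 1 ∧
  ∃ (M : ℕ → Submodule ℂ H) (hM : ∀ n, ∀ x ∈ M n, T x ∈ M n),
    (∀ n, IsClosed (M n : Set H)) ∧
    (⨆ n, M n).topologicalClosure = ⊤ ∧
    ∀ n, spectrum ℂ (T.restrict (hM n)) ⊆ Metric.ball (0 : ℂ) 1

/-- Unitary equivalence of operators. -/
def UnitarilyEquivalent (T : H →L[ℂ] H) (R : K →L[ℂ] K) : Prop :=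
  ∃ W : H ≃ₗᵢ[ℂ] K, ∀ x : H, W (T x) = R (W x)

/-- The point spectrum, i.e. the set of eigenvalues. -/
def pointSpectrum (T : H →L[ℂ] H) : Set ℂ :=
  {z : ℂ | Module.End.HasEigenvalue (T : H →ₗ[ℂ] H) z}

end Operators

section Function_spaces

/-- Polar coordinates `(r, t) ↦ r e^{2πit}`, from `(0,1) × ℝ/ℤ` to the disc. -/
def polarDisc (p : Ioo (0 : ℝ) 1 × UnitAddCircle) : Disc :=
  ⟨((p.1 : ℝ) : ℂ) * (AddCircle.toCircle p.2 : ℂ), by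
    have h := p.1.2
    rw [mem_ball_zero_iff, norm_mul, Circle.norm_coe, mul_one, Complex.norm_real,
      Real.norm_eq_abs, abs_of_pos h.1]
    exact h.2⟩

/-- The rotation invariant measure `dμ(rζ) = dm(ζ) dν(r)` on the disc: the image of `ν × m` in
polar coordinates, where `m` is normalized arc length on the circle, i.e. normalized Haar measure
on `ℝ/ℤ` in the coordinate `ζ = e^{2πit}`. -/
def rotMeasure (ν : Measure (Ioo (0 : ℝ) 1)) : Measure Disc :=
  (ν.prod (AddCircle.haarAddCircle (T := 1))).map polarDisc

instance rotMeasure_isFinite (ν : Measure (Ioo (0 : ℝ) 1)) [IsFiniteMeasure ν] :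
    IsFiniteMeasure (rotMeasure ν) := by
  unfold rotMeasure; infer_instance

theorem continuous_polarDisc : Continuous polarDisc := by
  refine Continuous.subtype_mk ?_ _
  refine Continuous.mul (by fun_prop) ?_
  exact continuous_subtype_val.comp (AddCircle.continuous_toCircle.comp continuous_snd)

variable (μ : Measure Disc)

theorem memLp_coord : MemLp (fun z : Disc => (z : ℂ)) ∞ μ := by
  refine memLp_top_of_bound (continuous_subtype_val.aestronglyMeasurable) 1 (.of_forall fun z => ?_)
  have := z.2
  rw [mem_ball_zero_iff] at this
  exact this.le

/-- The operator of multiplication by the coordinate `χ(z) = z` on `L²(𝔻, μ)`. -/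
def mulCoord : Lp ℂ 2 μ →L[ℂ] Lp ℂ 2 μ :=
  (ContinuousLinearMap.mul ℂ ℂ).holderL μ ∞ 2 2 ((memLp_coord μ).toLp _)

theorem mulCoord_coeFn (f : Lp ℂ 2 μ) : mulCoord μ f =ᵐ[μ] fun z : Disc => (z : ℂ) * f z := by
  have h1 := (ContinuousLinearMap.mul ℂ ℂ).coeFn_holder (r := 2) ((memLp_coord μ).toLp _) f
  filter_upwards [h1, (memLp_coord μ).coeFn_toLp] with z h1 h2
  rw [ContinuousLinearMap.mul_apply', h2] at h1
  exact h1

/-- The set of all (classes of) functions in `L²(𝔻, μ)` whose complex conjugate is analytic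
in `𝔻`. -/
def conjL2a : Set (Lp ℂ 2 μ) :=
  {f | ∃ g : ℂ → ℂ, AnalyticOnNhd ℂ g (Metric.ball 0 1) ∧ f =ᵐ[μ] fun z : Disc => conj (g z)}

variable [IsFiniteMeasure μ]

theorem memLp_conjPow (n : ℕ) : MemLp (fun z : Disc => conj (z : ℂ) ^ n) 2 μ := by
  refine MemLp.of_bound (Continuous.aestronglyMeasurable (by fun_prop)) 1 (.of_forall fun z => ?_)
  have := z.2
  rw [mem_ball_zero_iff] at this
  rw [norm_pow, RCLike.norm_conj]
  exact pow_le_one₀ (norm_nonneg _) this.le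

/-- The function `z ↦ conj z ^ n` as an element of `L²(𝔻, μ)`. -/
def conjPow (n : ℕ) : Lp ℂ 2 μ := (memLp_conjPow μ n).toLp _

/-- The closed linear span of the functions `conj z ^ n`, `n ≥ 0`, in `L²(𝔻, μ)`. -/
def conjP2 : Submodule ℂ (Lp ℂ 2 μ) :=
  (Submodule.span ℂ (range (conjPow μ))).topologicalClosure

theorem mem_conjP2_orthogonal_iff (f : Lp ℂ 2 μ) :
    f ∈ (conjP2 μ)ᗮ ↔ ∀ n, inner ℂ (conjPow μ n) f = 0 := by
  rw [conjP2, Submodule.orthogonal_closure]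
  constructor
  · intro h n
    exact (Submodule.mem_orthogonal _ _).1 h _ (Submodule.subset_span ⟨n, rfl⟩)
  · intro h
    rw [Submodule.mem_orthogonal]
    intro u hu
    induction hu using Submodule.span_induction with
    | mem x hx => obtain ⟨n, rfl⟩ := hx; exact h n
    | zero => simp
    | add x y _ _ hx hy => rw [inner_add_left, hx, hy, add_zero]
    | smul a x _ hx => rw [inner_smul_left, hx, mul_zero]

theorem inner_conjPow_mulCoord (n : ℕ) (f : Lp ℂ 2 μ) :
    inner ℂ (conjPow μ n) (mulCoord μ f) = inner ℂ (conjPow μ (n + 1)) f := by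
  rw [L2.inner_def, L2.inner_def]
  refine integral_congr_ae ?_
  filter_upwards [mulCoord_coeFn μ f, (memLp_conjPow μ n).coeFn_toLp,
    (memLp_conjPow μ (n + 1)).coeFn_toLp] with z h1 h2 h3
  simp only [conjPow]
  rw [h1, h2, h3]
  simp only [RCLike.inner_apply, map_pow, Complex.conj_conj]
  ring

theorem mulCoord_mem_orthogonal :
    ∀ f ∈ (conjP2 μ)ᗮ, mulCoord μ f ∈ (conjP2 μ)ᗮ := by
  intro f hf
  rw [mem_conjP2_orthogonal_iff] at hf ⊢
  intro n
  rw [inner_conjPow_mulCoord]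
  exact hf (n + 1)

/-- The operator `T` of multiplication by the coordinate `χ(z) = z` acting on the orthogonal
complement of `conjP2 μ` in `L²(𝔻, μ)`. -/
def coordOp : (conjP2 μ)ᗮ →L[ℂ] (conjP2 μ)ᗮ :=
  (mulCoord μ).restrict (mulCoord_mem_orthogonal μ)

end Function_spaces

end

open Filter Topology

/-! ### Orthogonal expansions in a Hilbert space -/

section Hilbert_space

variable {E : Type*} [NormedAddCommGroup E] [InnerProductSpace ℂ E]

/-! Write `v_n` for the function `conj z ^ n`. Rotation invariance makes the `v_n` pairwise
orthogonal, and they stay so after cutting off to any disc `|z| ≤ ρ`. Elements of `conjP2` are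
therefore sums of orthogonal series. Since mass accumulates at the unit circle, `‖v_n‖ ≥ c ρ ^ n`
for every `ρ < 1`, so the coefficients give a power series converging in the whole disc
(`conjP2_subset_conjL2a`). Conversely, a conjugate analytic `f` and its projection onto `conjP2`
have the same coefficients, hence the same power series (`conjL2a_subset_conjP2`).

Subnormality is immediate, and rotations of the disc implement the equivalence of `T` and `ξ T`. For
purity, normality on a reducing subspace forces `T*` to be multiplication by `conj z` there; by
Stone–Weierstrass each `f` in the subspace satisfies `∫ p f = 0` for all continuous `p`, so `f = 0`.
The subspaces of functions supported in `|z| ≤ ρ` exhaust the space (`closure_iSup_truncSubspace`).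
Functions supported in `|z| > ρ` give `‖T ^ n‖ ≥ ρ ^ n`, so the spectral radius is 1, and rotation
spreads one spectral point over the circle.

If `T* f = c f` and `w = conj c`, then `conj f · (z - w)` is an analytic `g`. If `g(w) = 0` or `|w|
≥ 1`, division puts `f` in `conjP2`, so `f = 0`. Otherwise `1 / |z - w|²` is `μ`-integrable; but the
Poisson kernel integrates to `∫ dm(ζ) / |rζ - w|² = 1 / |r² - |w|²|`, contradicting the divergence
hypothesis. -/

theorem Orthonormal.hasSum_inner_smul_of_mem_closure [CompleteSpace E] {u : ℕ → E}
    (hu : Orthonormal ℂ u) {x : E}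
    (hx : x ∈ (Submodule.span ℂ (range u)).topologicalClosure) :
    HasSum (fun n => inner ℂ (u n) x • u n) x := by
  have hmem : x ∈ LinearMap.range hu.orthogonalFamily.linearIsometry.toLinearMap := by
    have hsup : (⨆ i, LinearMap.range (LinearIsometry.toSpanSingleton ℂ E (hu.1 i)).toLinearMap) =
        Submodule.span ℂ (range u) := by
      rw [← Set.iUnion_singleton_eq_range, Submodule.span_iUnion]
      exact iSup_congr fun i => (LinearMap.span_singleton_eq_range ℂ E (u i)).symm
    rw [OrthogonalFamily.range_linearIsometry, hsup]
    exact hx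
  obtain ⟨f, rfl⟩ := hmem
  have hs := hu.orthogonalFamily.hasSum_linearIsometry f
  have hc : ∀ n, inner ℂ (u n) (hu.orthogonalFamily.linearIsometry f) = f n := by
    intro n
    classical
    have h1 := hs.mapL (innerSL ℂ (u n))
    have h2 : HasSum (fun i => innerSL ℂ (u n) (LinearIsometry.toSpanSingleton ℂ E (hu.1 i) (f i)))
        (f n) := by
      convert hasSum_ite_eq n (f n) using 2 with i
      simp only [LinearIsometry.toSpanSingleton_apply, innerSL_apply_apply, inner_smul_right]
      rw [orthonormal_iff_ite.1 hu]
      split_ifs with h1 h2 h2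
      · rw [← h1, mul_one]
      · exact absurd h1.symm h2
      · exact absurd h2.symm h1
      · rw [mul_zero]
    exact h1.unique h2
  simpa [hc] using hs

/-- The unnormalized form keeps the vectors `conj z ^ n` themselves, so that the coefficients are
those of a power series. -/
theorem hasSum_inner_div_smul_of_mem_closure [CompleteSpace E] {v : ℕ → E}
    (hv : ∀ i j, i ≠ j → inner ℂ (v i) (v j) = 0) (h0 : ∀ i, v i ≠ 0) {x : E}
    (hx : x ∈ (Submodule.span ℂ (range v)).topologicalClosure) :
    HasSum (fun n => (inner ℂ (v n) x / (‖v n‖ : ℂ) ^ 2) • v n) x := by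
  set u : ℕ → E := fun n => ((‖v n‖ : ℂ)⁻¹) • v n with hu
  have hn : ∀ n, (‖v n‖ : ℂ) ≠ 0 := fun n => by simpa using h0 n
  have hou : Orthonormal ℂ u := by
    refine ⟨fun n => ?_, fun i j hij => ?_⟩
    · simp only [hu, norm_smul, norm_inv, Complex.norm_real, norm_norm]
      exact inv_mul_cancel₀ (norm_ne_zero_iff.2 (h0 n))
    · simp only [hu, inner_smul_left, inner_smul_right, hv i j hij, mul_zero]
  have hspan : Submodule.span ℂ (range u) = Submodule.span ℂ (range v) := by
    apply le_antisymm
    · rw [Submodule.span_le]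
      rintro _ ⟨n, rfl⟩
      exact Submodule.smul_mem _ _ (Submodule.subset_span ⟨n, rfl⟩)
    · rw [Submodule.span_le]
      rintro _ ⟨n, rfl⟩
      have : v n = (‖v n‖ : ℂ) • u n := by simp [hu, smul_smul, hn n]
      rw [this]
      exact Submodule.smul_mem _ _ (Submodule.subset_span ⟨n, rfl⟩)
  rw [← hspan] at hx
  convert hou.hasSum_inner_smul_of_mem_closure hx using 2 with n
  simp only [hu, inner_smul_left, smul_smul, map_inv₀, Complex.conj_ofReal]
  congr 1
  field_simp [hn n]

end Hilbert_space

noncomputable section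

/-! ### Multiplication operators and radial cut-offs -/

section Multiplication_operators

variable (μ : Measure Disc)

/-- Multiplication by an essentially bounded function on `L²(𝔻, μ)`. -/
def mulOp (φ : Disc → ℂ) (hφ : MemLp φ ∞ μ) : Lp ℂ 2 μ →L[ℂ] Lp ℂ 2 μ :=
  (ContinuousLinearMap.mul ℂ ℂ).holderL μ ∞ 2 2 (hφ.toLp φ)

variable {μ}

theorem mulOp_coeFn {φ : Disc → ℂ} (hφ : MemLp φ ∞ μ) (f : Lp ℂ 2 μ) :
    mulOp μ φ hφ f =ᵐ[μ] fun z => φ z * f z := by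
  have h1 := (ContinuousLinearMap.mul ℂ ℂ).coeFn_holder (r := 2) (hφ.toLp _) f
  filter_upwards [h1, hφ.coeFn_toLp] with z h1 h2
  rw [ContinuousLinearMap.mul_apply', h2] at h1
  exact h1

theorem norm_mulOp_apply_le {φ : Disc → ℂ} (hφ : MemLp φ ∞ μ) {C : ℝ}
    (hC : ∀ z, ‖φ z‖ ≤ C) (f : Lp ℂ 2 μ) : ‖mulOp μ φ hφ f‖ ≤ C * ‖f‖ := by
  refine Lp.norm_le_mul_norm_of_ae_le_mul ?_
  filter_upwards [mulOp_coeFn hφ f] with z hz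
  rw [hz, norm_mul]
  exact mul_le_mul_of_nonneg_right (hC z) (norm_nonneg _)

theorem memLp_top_conj {φ : Disc → ℂ} (hφ : MemLp φ ∞ μ) :
    MemLp (fun z => conj (φ z)) ∞ μ := hφ.star

theorem memLp_top_mul {φ ψ : Disc → ℂ} (hφ : MemLp φ ∞ μ) (hψ : MemLp ψ ∞ μ) :
    MemLp (fun z => φ z * ψ z) ∞ μ := hψ.mul hφ

theorem inner_mulOp_left {φ : Disc → ℂ} (hφ : MemLp φ ∞ μ) (f g : Lp ℂ 2 μ) :
    inner ℂ (mulOp μ φ hφ f) g = inner ℂ f (mulOp μ _ (memLp_top_conj hφ) g) := by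
  rw [L2.inner_def, L2.inner_def]
  refine integral_congr_ae ?_
  filter_upwards [mulOp_coeFn hφ f, mulOp_coeFn (memLp_top_conj hφ) g] with z h1 h2
  simp only [h1, h2, RCLike.inner_apply, map_mul]
  ring

theorem adjoint_mulOp {φ : Disc → ℂ} (hφ : MemLp φ ∞ μ) :
    ContinuousLinearMap.adjoint (mulOp μ φ hφ) = mulOp μ _ (memLp_top_conj hφ) := by
  symm
  rw [ContinuousLinearMap.eq_adjoint_iff]
  intro f g
  rw [inner_mulOp_left]
  congr 1
  apply Lp.ext
  filter_upwards [mulOp_coeFn (memLp_top_conj (memLp_top_conj hφ)) g, mulOp_coeFn hφ g] with z h1 h2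
  rw [h1, h2, Complex.conj_conj]

theorem mulOp_mulOp {φ ψ : Disc → ℂ} (hφ : MemLp φ ∞ μ) (hψ : MemLp ψ ∞ μ) (f : Lp ℂ 2 μ) :
    mulOp μ φ hφ (mulOp μ ψ hψ f) = mulOp μ _ (memLp_top_mul hφ hψ) f := by
  apply Lp.ext
  filter_upwards [mulOp_coeFn hφ (mulOp μ ψ hψ f), mulOp_coeFn hψ f,
    mulOp_coeFn (memLp_top_mul hφ hψ) f] with z h1 h2 h3
  rw [h1, h2, h3, mul_assoc]

theorem mulOp_comm {φ ψ : Disc → ℂ} (hφ : MemLp φ ∞ μ) (hψ : MemLp ψ ∞ μ) (f : Lp ℂ 2 μ) :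
    mulOp μ φ hφ (mulOp μ ψ hψ f) = mulOp μ ψ hψ (mulOp μ φ hφ f) := by
  rw [mulOp_mulOp, mulOp_mulOp]
  simp only [mul_comm]

theorem mulCoord_eq_mulOp : mulCoord μ = mulOp μ (fun z => (z : ℂ)) (memLp_coord μ) := rfl

variable (μ) in
/-- Multiplication by the conjugate coordinate. -/
def mulConjCoord : Lp ℂ 2 μ →L[ℂ] Lp ℂ 2 μ := mulOp μ _ (memLp_top_conj (memLp_coord μ))

theorem adjoint_mulCoord : ContinuousLinearMap.adjoint (mulCoord μ) = mulConjCoord μ :=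
  adjoint_mulOp (memLp_coord μ)

theorem mulConjCoord_coeFn (f : Lp ℂ 2 μ) :
    mulConjCoord μ f =ᵐ[μ] fun z : Disc => conj (z : ℂ) * f z :=
  mulOp_coeFn _ f

theorem norm_coe_disc_lt_one (z : Disc) : ‖(z : ℂ)‖ < 1 :=
  mem_ball_zero_iff.1 z.2

theorem norm_mulCoord_apply_le (f : Lp ℂ 2 μ) : ‖mulCoord μ f‖ ≤ ‖f‖ := by
  have h := norm_mulOp_apply_le (memLp_coord μ) (fun z => (norm_coe_disc_lt_one z).le) f
  rwa [one_mul] at h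

theorem isStarNormal_mulCoord : IsStarNormal (mulCoord μ) := by
  rw [isStarNormal_iff, ContinuousLinearMap.star_eq_adjoint, adjoint_mulCoord]
  ext1 f
  exact mulOp_comm _ _ f

/-- The indicator function of the closed disc of radius `ρ`. -/
def discInd (ρ : ℝ) (z : Disc) : ℂ := {z : Disc | ‖(z : ℂ)‖ ≤ ρ}.indicator (fun _ => 1) z

theorem measurableSet_norm_le (ρ : ℝ) : MeasurableSet {z : Disc | ‖(z : ℂ)‖ ≤ ρ} :=
  measurableSet_le (by fun_prop) (by fun_prop)

theorem memLp_discInd (ρ : ℝ) : MemLp (discInd ρ) ∞ μ := by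
  refine memLp_top_of_bound (C := 1) ?_ (.of_forall fun z => ?_)
  · exact (aestronglyMeasurable_const.indicator (measurableSet_norm_le ρ))
  · unfold discInd
    by_cases h : z ∈ {z : Disc | ‖(z : ℂ)‖ ≤ ρ} <;> simp [h]

theorem discInd_of_le {ρ : ℝ} {z : Disc} (h : ‖(z : ℂ)‖ ≤ ρ) : discInd ρ z = 1 := by
  simp [discInd, h]

theorem discInd_of_lt {ρ : ℝ} {z : Disc} (h : ρ < ‖(z : ℂ)‖) : discInd ρ z = 0 := by
  simp [discInd, h]

theorem conj_discInd (ρ : ℝ) (z : Disc) : conj (discInd ρ z) = discInd ρ z := by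
  rcases le_or_gt ‖(z : ℂ)‖ ρ with h | h
  · simp [discInd_of_le h]
  · simp [discInd_of_lt h]

variable (μ) in
/-- Restriction of functions to the closed disc of radius `ρ`. -/
def truncOp (ρ : ℝ) : Lp ℂ 2 μ →L[ℂ] Lp ℂ 2 μ := mulOp μ (discInd ρ) (memLp_discInd ρ)

theorem truncOp_coeFn (ρ : ℝ) (f : Lp ℂ 2 μ) :
    truncOp μ ρ f =ᵐ[μ] fun z => discInd ρ z * f z := mulOp_coeFn _ f

theorem truncOp_of_ae_eq {ρ : ℝ} {f : Lp ℂ 2 μ} (h : ∀ᵐ z : Disc ∂μ, ρ < ‖(z : ℂ)‖ → f z = 0) :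
    truncOp μ ρ f = f := by
  apply Lp.ext
  filter_upwards [truncOp_coeFn ρ f, h] with z h1 h2
  rw [h1]
  rcases le_or_gt ‖(z : ℂ)‖ ρ with h | h
  · simp [discInd_of_le h]
  · simp [h2 h]

theorem truncOp_one (f : Lp ℂ 2 μ) : truncOp μ 1 f = f :=
  truncOp_of_ae_eq (.of_forall fun z h => absurd h (norm_coe_disc_lt_one z).not_gt)

theorem truncOp_truncOp {ρ σ : ℝ} (hρσ : ρ ≤ σ) (f : Lp ℂ 2 μ) :
    truncOp μ σ (truncOp μ ρ f) = truncOp μ ρ f := by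
  refine truncOp_of_ae_eq ?_
  filter_upwards [truncOp_coeFn ρ f] with z h1 h2
  rw [h1, discInd_of_lt (hρσ.trans_lt h2), zero_mul]

theorem inner_truncOp_left (ρ : ℝ) (f g : Lp ℂ 2 μ) :
    inner ℂ (truncOp μ ρ f) g = inner ℂ f (truncOp μ ρ g) := by
  rw [truncOp, inner_mulOp_left]
  simp only [conj_discInd]

theorem norm_mulCoord_truncOp_le {ρ : ℝ} (hρ : 0 ≤ ρ) (f : Lp ℂ 2 μ) :
    ‖mulCoord μ (truncOp μ ρ f)‖ ≤ ρ * ‖f‖ := by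
  rw [mulCoord_eq_mulOp, truncOp, mulOp_mulOp]
  refine norm_mulOp_apply_le _ (fun z => ?_) f
  rcases le_or_gt ‖(z : ℂ)‖ ρ with h | h
  · simpa [discInd_of_le h] using h
  · simpa [discInd_of_lt h] using hρ

/-- Dominated convergence: every point of the open disc eventually lies inside the cut-off radius.
Weak convergence is all that the later limits need. -/
theorem tendsto_inner_truncOp {ρ : ℕ → ℝ} (hρ : Tendsto ρ atTop (𝓝 1))
    (f g : Lp ℂ 2 μ) :
    Tendsto (fun n => inner ℂ f (truncOp μ (ρ n) g)) atTop (𝓝 (inner ℂ f g)) := by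
  simp only [L2.inner_def]
  refine tendsto_integral_of_dominated_convergence (fun z => ‖inner ℂ (f z) (g z)‖)
    (fun n => (L2.integrable_inner f (truncOp μ (ρ n) g)).1)
    (L2.integrable_inner f g).norm (fun n => ?_) ?_
  · filter_upwards [truncOp_coeFn (ρ n) g] with z h
    rw [h]
    rcases le_or_gt ‖(z : ℂ)‖ (ρ n) with h | h
    · simp [discInd_of_le h]
    · simp [discInd_of_lt h]
      positivity
  · have := ae_all_iff.2 fun n => truncOp_coeFn (μ := μ) (ρ n) g
    filter_upwards [this] with z hz
    refine tendsto_const_nhds.congr' ?_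
    filter_upwards [hρ.eventually (lt_mem_nhds (norm_coe_disc_lt_one z))] with n hn
    rw [hz n, discInd_of_le hn.le, one_mul]

end Multiplication_operators

/-! ### Rotation invariance and vanishing moments -/

section Rotations

/-- The rotation `z ↦ ξ z` of the disc. -/
def rotDisc (ξ : Circle) : Disc ≃ₜ Disc where
  toFun z := ⟨ξ * z, by
    rw [mem_ball_zero_iff, norm_mul, Circle.norm_coe, one_mul]
    exact norm_coe_disc_lt_one z⟩
  invFun z := ⟨(ξ⁻¹ : Circle) * z, by
    rw [mem_ball_zero_iff, norm_mul, Circle.norm_coe, one_mul]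
    exact norm_coe_disc_lt_one z⟩
  left_inv z := Subtype.ext (by simp)
  right_inv z := Subtype.ext (by simp)
  continuous_toFun := by fun_prop
  continuous_invFun := by fun_prop

@[simp] theorem coe_rotDisc (ξ : Circle) (z : Disc) : ((rotDisc ξ z : Disc) : ℂ) = ξ * z := rfl

/-- Invariance of a measure on the disc under all rotations. -/
def IsRotInvariant (μ : Measure Disc) : Prop :=
  ∀ ξ : Circle, MeasurePreserving (rotDisc ξ) μ μ

theorem isRotInvariant_rotMeasure (ν : Measure (Ioo (0 : ℝ) 1)) [IsFiniteMeasure ν] :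
    IsRotInvariant (rotMeasure ν) := by
  intro ξ
  obtain ⟨s, rfl⟩ : ∃ s : UnitAddCircle, AddCircle.toCircle s = ξ :=
    ⟨(AddCircle.homeomorphCircle one_ne_zero).symm ξ, by
      rw [← AddCircle.homeomorphCircle_apply one_ne_zero, Homeomorph.apply_symm_apply]⟩
  have h1 : MeasurePreserving
      (Prod.map id (s + ·) : Ioo (0 : ℝ) 1 × UnitAddCircle → Ioo (0 : ℝ) 1 × UnitAddCircle)
      (ν.prod (AddCircle.haarAddCircle (T := 1))) (ν.prod (AddCircle.haarAddCircle (T := 1))) :=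
    (MeasurePreserving.id ν).prod (measurePreserving_add_left _ s)
  have hp := continuous_polarDisc.measurable
  refine ⟨(rotDisc _).continuous.measurable, ?_⟩
  rw [rotMeasure, Measure.map_map (rotDisc _).continuous.measurable hp]
  conv_rhs => rw [← h1.map_eq, Measure.map_map hp h1.measurable]
  congr 1
  ext p
  simp only [Function.comp_apply, coe_rotDisc, polarDisc, Prod.map_fst, Prod.map_snd, id,
    AddCircle.toCircle_add, Circle.coe_mul]
  ring

variable {μ : Measure Disc}

/-- The change of variables `z ↦ ξ z` shows that the integral equals `c` times itself. -/
theorem IsRotInvariant.integral_eq_zero (hμ : IsRotInvariant μ) {F : Disc → ℂ} (ξ : Circle)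
    {c : ℂ} (hF : ∀ z, F (rotDisc ξ z) = c * F z) (hc : c ≠ 1) : ∫ z, F z ∂μ = 0 := by
  have h := (hμ ξ).integral_comp (rotDisc ξ).measurableEmbedding F
  simp only [hF, integral_const_mul] at h
  have h2 : (c - 1) * ∫ z, F z ∂μ = 0 := by rw [sub_mul, h, one_mul, sub_self]
  exact (mul_eq_zero.1 h2).resolve_left (sub_ne_zero.2 hc)

theorem exists_circle_pow_ne {j k : ℕ} (h : j ≠ k) :
    ∃ ξ : Circle, (ξ : ℂ) ^ j * conj (ξ : ℂ) ^ k ≠ 1 := by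
  have hd : ((j : ℝ) - k) ≠ 0 := sub_ne_zero.2 (by exact_mod_cast h)
  -- This angle makes `ξ ^ j * conj ξ ^ k` equal to `exp (π i) = -1`.
  refine ⟨Circle.exp (Real.pi / (j - k)), ?_⟩
  rw [← Circle.coe_inv_eq_conj, Circle.coe_exp, ← Circle.exp_neg, Circle.coe_exp, ← Complex.exp_nat_mul,
    ← Complex.exp_nat_mul, ← Complex.exp_add]
  have : (j : ℂ) * ((Real.pi / (j - k) : ℝ) * Complex.I) +
      k * ((-(Real.pi / (j - k)) : ℝ) * Complex.I) = Real.pi * Complex.I := by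
    have hd' : ((j : ℂ) - k) ≠ 0 := by exact_mod_cast hd
    push_cast
    field_simp
    ring
  rw [this, Complex.exp_pi_mul_I]
  norm_num

/-- The radial weight `φ` is there so that orthogonality of the powers survives the cut-offs. -/
theorem IsRotInvariant.integral_radial_mul_pow (hμ : IsRotInvariant μ) {φ : Disc → ℂ}
    (hφ : ∀ ξ z, φ (rotDisc ξ z) = φ z) {j k : ℕ} (h : j ≠ k) :
    ∫ z : Disc, φ z * ((z : ℂ) ^ j * conj (z : ℂ) ^ k) ∂μ = 0 := by
  obtain ⟨ξ, hξ⟩ := exists_circle_pow_ne h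
  refine hμ.integral_eq_zero ξ (fun z => ?_) hξ
  simp only [hφ, coe_rotDisc, map_mul, mul_pow]
  ring

theorem discInd_rotDisc (ρ : ℝ) (ξ : Circle) (z : Disc) :
    discInd ρ (rotDisc ξ z) = discInd ρ z := by
  simp [discInd, Set.indicator, Circle.norm_coe]

end Rotations

end
noncomputable section

/-! ### Subnormality and the exhausting invariant subspaces -/

section Invariant_subspaces

variable {μ : Measure Disc} [IsFiniteMeasure μ]

theorem conjPow_coeFn (n : ℕ) : conjPow μ n =ᵐ[μ] fun z : Disc => conj (z : ℂ) ^ n :=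
  (memLp_conjPow μ n).coeFn_toLp

theorem inner_conjPow (n : ℕ) (f : Lp ℂ 2 μ) :
    inner ℂ (conjPow μ n) f = ∫ z : Disc, f z * (z : ℂ) ^ n ∂μ := by
  rw [L2.inner_def]
  refine integral_congr_ae ?_
  filter_upwards [conjPow_coeFn (μ := μ) n] with z hz
  simp [hz]

theorem IsRotInvariant.inner_conjPow_truncOp (hμ : IsRotInvariant μ) (ρ : ℝ) {j k : ℕ}
    (h : j ≠ k) : inner ℂ (conjPow μ j) (truncOp μ ρ (conjPow μ k)) = 0 := by
  rw [inner_conjPow]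
  refine (integral_congr_ae ?_).trans (hμ.integral_radial_mul_pow (discInd_rotDisc ρ) h)
  filter_upwards [conjPow_coeFn (μ := μ) k, truncOp_coeFn ρ (conjPow μ k)] with z h1 h2
  rw [h2, h1]
  ring

theorem IsRotInvariant.inner_conjPow_conjPow (hμ : IsRotInvariant μ) {j k : ℕ}
    (h : j ≠ k) : inner ℂ (conjPow μ j) (conjPow μ k) = 0 := by
  simpa only [truncOp_one] using hμ.inner_conjPow_truncOp 1 h

theorem conjPow_ne_zero (h : 0 < μ {z : Disc | 0 < ‖(z : ℂ)‖}) (n : ℕ) : conjPow μ n ≠ 0 := by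
  intro h0
  have h1 : ∀ᵐ z : Disc ∂μ, ¬ 0 < ‖(z : ℂ)‖ := by
    have h2 : conjPow μ n =ᵐ[μ] 0 := by rw [h0]; exact Lp.coeFn_zero _ _ _
    filter_upwards [conjPow_coeFn (μ := μ) n, h2] with z h3 h4 h5
    rw [h4] at h3
    exact pow_ne_zero n ((map_ne_zero _).2 (norm_pos_iff.1 h5)) h3.symm
  exact h.ne' (by simpa [ae_iff] using h1)

theorem coe_coordOp (f : (conjP2 μ)ᗮ) :
    ((coordOp μ f : (conjP2 μ)ᗮ) : Lp ℂ 2 μ) = mulCoord μ f := rfl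

theorem norm_coordOp_le : ‖coordOp μ‖ ≤ 1 :=
  ContinuousLinearMap.opNorm_le_bound _ zero_le_one fun f => by
    rw [one_mul]
    exact norm_mulCoord_apply_le (f : Lp ℂ 2 μ)

theorem isSubnormal_coordOp : IsSubnormal (coordOp μ) :=
  ⟨Lp ℂ 2 μ, inferInstance, inferInstance, inferInstance, mulCoord μ,
    (conjP2 μ)ᗮ.subtypeₗᵢ, isStarNormal_mulCoord, fun _ => rfl⟩

variable (μ) in
/-- The functions in the orthogonal complement of `conjP2 μ` that vanish off the closed disc of
radius `ρ`. -/
def truncSubspace (ρ : ℝ) : Submodule ℂ (conjP2 μ)ᗮ :=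
  LinearMap.ker (((truncOp μ ρ - ContinuousLinearMap.id ℂ _) ∘L (conjP2 μ)ᗮ.subtypeL :
    (conjP2 μ)ᗮ →L[ℂ] Lp ℂ 2 μ) : (conjP2 μ)ᗮ →ₗ[ℂ] Lp ℂ 2 μ)

theorem mem_truncSubspace {ρ : ℝ} {f : (conjP2 μ)ᗮ} :
    f ∈ truncSubspace μ ρ ↔ truncOp μ ρ f = f := by
  simp [truncSubspace, sub_eq_zero]

theorem isClosed_truncSubspace (ρ : ℝ) : IsClosed (truncSubspace μ ρ : Set (conjP2 μ)ᗮ) :=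
  ContinuousLinearMap.isClosed_ker _

theorem coordOp_mem_truncSubspace (ρ : ℝ) :
    ∀ f ∈ truncSubspace μ ρ, coordOp μ f ∈ truncSubspace μ ρ := by
  intro f hf
  rw [mem_truncSubspace] at hf ⊢
  rw [coe_coordOp, mulCoord_eq_mulOp, truncOp, mulOp_comm]
  rw [truncOp] at hf
  rw [hf]

theorem spectrum_subset_closedBall_of_norm_le {E : Type*} [NormedAddCommGroup E]
    [NormedSpace ℂ E] [CompleteSpace E] {T : E →L[ℂ] E} {ρ : ℝ} (hT : ‖T‖ ≤ ρ) :
    spectrum ℂ T ⊆ Metric.closedBall 0 ρ := by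
  -- A truncated subspace may be zero; there the identity does not have norm one, and the spectrum
  -- is empty.
  rcases subsingleton_or_nontrivial E with hE | hE
  · rw [spectrum.of_subsingleton]
    exact empty_subset _
  · exact (spectrum.subset_closedBall_norm T).trans (Metric.closedBall_subset_closedBall hT)

theorem spectrum_restrict_truncSubspace {ρ : ℝ} (h0 : 0 ≤ ρ) (h1 : ρ < 1) :
    spectrum ℂ ((coordOp μ).restrict (coordOp_mem_truncSubspace ρ)) ⊆ Metric.ball 0 1 := by
  have : CompleteSpace (truncSubspace μ ρ) := (isClosed_truncSubspace ρ).completeSpace_coe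
  refine (spectrum_subset_closedBall_of_norm_le (ρ := ρ) ?_).trans (Metric.closedBall_subset_ball h1)
  refine ContinuousLinearMap.opNorm_le_bound _ h0 fun f => ?_
  have h := norm_mulCoord_truncOp_le h0 ((f : (conjP2 μ)ᗮ) : Lp ℂ 2 μ)
  rwa [mem_truncSubspace.1 f.2] at h

/-- Let `h` be orthogonal to all the subspaces. The aim is that each cut-off of `h` is again
orthogonal to `conjP2`. It then lies in one of the subspaces, so `⟨h, 1_ρ h⟩ = 0`, and letting `ρ →
1` gives `h = 0`. -/
theorem IsRotInvariant.closure_iSup_truncSubspace (hμ : IsRotInvariant μ)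
    (h0 : ∀ n, conjPow μ n ≠ 0) {ρ : ℕ → ℝ} (hm : Monotone ρ) (hρ : Tendsto ρ atTop (𝓝 1)) :
    (⨆ n, truncSubspace μ (ρ n)).topologicalClosure = ⊤ := by
  rw [Submodule.topologicalClosure_eq_top_iff, Submodule.eq_bot_iff]
  intro h hh
  have horth : ∀ n (u : Lp ℂ 2 μ), u ∈ (conjP2 μ)ᗮ → truncOp μ (ρ n) u = u →
      inner ℂ u (h : Lp ℂ 2 μ) = 0 := by
    intro n u hu hun
    have hmem : (⟨u, hu⟩ : (conjP2 μ)ᗮ) ∈ truncSubspace μ (ρ n) := mem_truncSubspace.2 hun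
    exact (Submodule.mem_orthogonal _ _).1 hh _ (Submodule.mem_iSup_of_mem n hmem)
  have hcoef : ∀ m k, inner ℂ (conjPow μ k) (truncOp μ (ρ m) h) = 0 := by
    intro m k
    set v := conjPow μ k with hv
    set A : ℕ → ℂ := fun n => inner ℂ v (truncOp μ (ρ n) v) with hA
    have hAh : ∀ n, m ≤ n → conj (A n) * inner ℂ v (truncOp μ (ρ m) h) =
        conj (A m) * inner ℂ v (truncOp μ (ρ n) (h : Lp ℂ 2 μ)) := by
      intro n hn
      -- The weights cancel the inner product with `v` itself; the other powers are orthogonal to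
      -- both cut-offs. Testing `h` against this vector and letting `n → ∞` turns `⟨v, h⟩ = 0` into
      -- `⟨v, 1_ρ h⟩ = 0`.
      have hu : A n • truncOp μ (ρ m) v - A m • truncOp μ (ρ n) v ∈ (conjP2 μ)ᗮ := by
        rw [mem_conjP2_orthogonal_iff]
        intro j
        rw [inner_sub_right, inner_smul_right, inner_smul_right]
        by_cases hjk : j = k
        · subst hjk
          simp only [hA, ← hv]
          ring
        · rw [hv, hμ.inner_conjPow_truncOp _ hjk, hμ.inner_conjPow_truncOp _ hjk]
          simp
      have := horth n _ hu (by
        rw [map_sub, map_smul, map_smul, truncOp_truncOp (hm hn), truncOp_truncOp le_rfl])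
      rw [inner_sub_left, inner_smul_left, inner_smul_left, inner_truncOp_left,
        inner_truncOp_left] at this
      exact sub_eq_zero.1 this
    have hlim1 : Tendsto (fun n => conj (A n) * inner ℂ v (truncOp μ (ρ m) h)) atTop
        (𝓝 (conj (inner ℂ v v) * inner ℂ v (truncOp μ (ρ m) h))) :=
      ((Complex.continuous_conj.tendsto _).comp (tendsto_inner_truncOp hρ v v)).mul_const _
    have hlim2 : Tendsto (fun n => conj (A m) * inner ℂ v (truncOp μ (ρ n) (h : Lp ℂ 2 μ))) atTop
        (𝓝 (conj (A m) * inner ℂ v h)) := (tendsto_inner_truncOp hρ v h).const_mul _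
    have hvh : inner ℂ v (h : Lp ℂ 2 μ) = 0 := (mem_conjP2_orthogonal_iff μ _).1 h.2 k
    have heq := tendsto_nhds_unique (hlim1.congr' ?_) hlim2
    · rw [hvh, mul_zero] at heq
      refine (mul_eq_zero.1 heq).resolve_left ?_
      exact (map_ne_zero _).2 (inner_self_ne_zero.2 (h0 k))
    · filter_upwards [eventually_ge_atTop m] with n hn using hAh n hn
  have hzero : ∀ m, inner ℂ (h : Lp ℂ 2 μ) (truncOp μ (ρ m) h) = 0 := by
    intro m
    rw [← inner_truncOp_left]
    exact horth m _ ((mem_conjP2_orthogonal_iff μ _).2 (hcoef m)) (truncOp_truncOp le_rfl _)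
  have hlim := tendsto_inner_truncOp hρ (h : Lp ℂ 2 μ) h
  simp only [hzero] at hlim
  have : inner ℂ (h : Lp ℂ 2 μ) (h : Lp ℂ 2 μ) = 0 := tendsto_nhds_unique hlim tendsto_const_nhds
  exact Subtype.ext (inner_self_eq_zero.1 this)

theorem IsRotInvariant.hasDiscSpectrumExhaustion (hμ : IsRotInvariant μ)
    (h0 : ∀ n, conjPow μ n ≠ 0) : HasDiscSpectrumExhaustion (coordOp μ) := by
  have hpos : ∀ n : ℕ, 0 < 1 / ((n : ℝ) + 1) := fun n => by positivity
  refine ⟨norm_coordOp_le, fun n => truncSubspace μ (1 - 1 / ((n : ℝ) + 1)),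
    fun n => coordOp_mem_truncSubspace _, fun n => isClosed_truncSubspace _,
    hμ.closure_iSup_truncSubspace h0 ?_ ?_, fun n => spectrum_restrict_truncSubspace ?_ ?_⟩
  · intro m n hmn
    have := Nat.one_div_le_one_div (α := ℝ) hmn
    simp only
    linarith
  · simpa using (tendsto_one_div_add_atTop_nhds_zero_nat (𝕜 := ℝ)).const_sub 1
  · rw [sub_nonneg, div_le_one (by positivity)]
    linarith [(Nat.cast_nonneg n : (0 : ℝ) ≤ n)]
  · linarith [hpos n]

end Invariant_subspaces

/-! ### Unitary equivalence under rotation -/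

section Rotation_operators

variable {μ : Measure Disc}

/-- Composition with a rotation on `L²(𝔻, μ)`. -/
def IsRotInvariant.rotOp (hμ : IsRotInvariant μ) (ξ : Circle) : Lp ℂ 2 μ →ₗᵢ[ℂ] Lp ℂ 2 μ :=
  Lp.compMeasurePreservingₗᵢ ℂ (rotDisc ξ) (hμ ξ)

theorem IsRotInvariant.rotOp_coeFn (hμ : IsRotInvariant μ) (ξ : Circle) (f : Lp ℂ 2 μ) :
    hμ.rotOp ξ f =ᵐ[μ] fun z => f (rotDisc ξ z) :=
  Lp.coeFn_compMeasurePreserving f (hμ ξ)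

theorem IsRotInvariant.rotOp_rotOp_inv (hμ : IsRotInvariant μ) (ξ : Circle) (f : Lp ℂ 2 μ) :
    hμ.rotOp ξ (hμ.rotOp ξ⁻¹ f) = f := by
  apply Lp.ext
  filter_upwards [hμ.rotOp_coeFn ξ (hμ.rotOp ξ⁻¹ f),
    (hμ ξ).quasiMeasurePreserving.ae (hμ.rotOp_coeFn ξ⁻¹ f)] with z h1 h2
  rw [h1, h2]
  congr 1
  ext
  simp

theorem IsRotInvariant.rotOp_mulCoord (hμ : IsRotInvariant μ) (ξ : Circle) (f : Lp ℂ 2 μ) :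
    hμ.rotOp ξ (mulCoord μ f) = (ξ : ℂ) • mulCoord μ (hμ.rotOp ξ f) := by
  apply Lp.ext
  filter_upwards [hμ.rotOp_coeFn ξ (mulCoord μ f), hμ.rotOp_coeFn ξ f,
    (hμ ξ).quasiMeasurePreserving.ae (mulCoord_coeFn μ f), mulCoord_coeFn μ (hμ.rotOp ξ f),
    Lp.coeFn_smul (ξ : ℂ) (mulCoord μ (hμ.rotOp ξ f))] with z h1 h2 h3 h4 h5
  rw [h1, h3, h5, Pi.smul_apply, h4, h2, coe_rotDisc, smul_eq_mul]
  ring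

variable [IsFiniteMeasure μ]

theorem IsRotInvariant.conjPow_eq_smul_rotOp (hμ : IsRotInvariant μ) (ξ : Circle) (n : ℕ) :
    conjPow μ n = (ξ : ℂ) ^ n • hμ.rotOp ξ (conjPow μ n) := by
  apply Lp.ext
  filter_upwards [hμ.rotOp_coeFn ξ (conjPow μ n), conjPow_coeFn (μ := μ) n,
    (hμ ξ).quasiMeasurePreserving.ae (conjPow_coeFn (μ := μ) n),
    Lp.coeFn_smul ((ξ : ℂ) ^ n) (hμ.rotOp ξ (conjPow μ n))] with z h1 h2 h3 h5
  rw [h2, h5, Pi.smul_apply, h1, h3, coe_rotDisc, smul_eq_mul, ← mul_pow, map_mul, ← mul_assoc,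
    Complex.mul_conj']
  simp [Circle.norm_coe]

theorem IsRotInvariant.rotOp_mem_orthogonal (hμ : IsRotInvariant μ) (ξ : Circle) :
    ∀ f ∈ (conjP2 μ)ᗮ, hμ.rotOp ξ f ∈ (conjP2 μ)ᗮ := by
  intro f hf
  rw [mem_conjP2_orthogonal_iff] at hf ⊢
  intro n
  rw [hμ.conjPow_eq_smul_rotOp ξ n, inner_smul_left, LinearIsometry.inner_map_map, hf n, mul_zero]

theorem IsRotInvariant.unitarilyEquivalent_smul (hμ : IsRotInvariant μ) (ξ : Circle) :
    UnitarilyEquivalent (coordOp μ) ((ξ : ℂ) • coordOp μ) := by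
  let V : (conjP2 μ)ᗮ →ₗᵢ[ℂ] (conjP2 μ)ᗮ :=
    { toLinearMap := (hμ.rotOp ξ).toLinearMap.restrict (hμ.rotOp_mem_orthogonal ξ)
      norm_map' := fun f => (hμ.rotOp ξ).norm_map f }
  have hV : Function.Surjective V := fun f =>
    ⟨⟨hμ.rotOp ξ⁻¹ f, hμ.rotOp_mem_orthogonal ξ⁻¹ f f.2⟩, Subtype.ext (hμ.rotOp_rotOp_inv ξ f)⟩
  exact ⟨LinearIsometryEquiv.ofSurjective V hV, fun f => Subtype.ext (hμ.rotOp_mulCoord ξ f)⟩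

end Rotation_operators

/-! ### The unit circle lies in the spectrum -/

section Spectrum

/-- Gelfand's formula gives spectral radius at least one, and the spectral radius is attained on the
spectrum. -/
theorem exists_mem_spectrum_norm_eq_one {E : Type*} [NormedAddCommGroup E] [NormedSpace ℂ E]
    [CompleteSpace E] [Nontrivial E] {T : E →L[ℂ] E} (hT : ‖T‖ ≤ 1)
    (hpow : ∀ n : ℕ, 1 ≤ ‖T ^ n‖) : ∃ z ∈ spectrum ℂ T, ‖z‖ = 1 := by
  have hrad : 1 ≤ spectralRadius ℂ T := by
    refine ge_of_tendsto' (spectrum.pow_nnnorm_pow_one_div_tendsto_nhds_spectralRadius T)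
      fun n => ?_
    have h1 : (1 : ℝ≥0∞) ≤ ‖T ^ n‖₊ := by exact_mod_cast hpow n
    have h2 := ENNReal.rpow_le_rpow h1 (by positivity : (0 : ℝ) ≤ 1 / n)
    rwa [ENNReal.one_rpow] at h2
  obtain ⟨z, hz, hzr⟩ := spectrum.exists_nnnorm_eq_spectralRadius T
  refine ⟨z, hz, le_antisymm ((spectrum.norm_le_norm_of_mem hz).trans hT) ?_⟩
  rw [← hzr] at hrad
  exact_mod_cast hrad

theorem UnitarilyEquivalent.spectrum_eq {H K : Type*} [NormedAddCommGroup H]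
    [InnerProductSpace ℂ H] [NormedAddCommGroup K] [InnerProductSpace ℂ K]
    {T : H →L[ℂ] H} {R : K →L[ℂ] K} (h : UnitarilyEquivalent T R) :
    spectrum ℂ T = spectrum ℂ R := by
  obtain ⟨W, hW⟩ := h
  have hR : R = W.toContinuousLinearEquiv.conjContinuousAlgEquiv T := by
    ext x
    simp [ContinuousLinearEquiv.conjContinuousAlgEquiv_apply, hW]
  rw [hR]
  exact (AlgEquiv.spectrum_eq W.toContinuousLinearEquiv.conjContinuousAlgEquiv T).symm

variable {μ : Measure Disc}

theorem norm_mulCoord_ge {ρ : ℝ} (hρ : 0 ≤ ρ) {f : Lp ℂ 2 μ} (hf : truncOp μ ρ f = 0) :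
    ρ * ‖f‖ ≤ ‖mulCoord μ f‖ := by
  have h : ‖(ρ : ℂ) • f‖ ≤ ‖mulCoord μ f‖ := by
    refine Lp.norm_le_norm_of_ae_le ?_
    have h0 : truncOp μ ρ f =ᵐ[μ] 0 := by rw [hf]; exact Lp.coeFn_zero _ _ _
    filter_upwards [mulCoord_coeFn μ f, Lp.coeFn_smul (ρ : ℂ) f, truncOp_coeFn ρ f, h0]
      with z h1 h2 h3 h4
    rw [h1, h2, Pi.smul_apply, norm_smul, norm_mul, Complex.norm_real, Real.norm_of_nonneg hρ]
    rcases le_or_gt ‖(z : ℂ)‖ ρ with h | h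
    · rw [h3, discInd_of_le h, one_mul] at h4
      simp [h4]
    · gcongr
  rwa [norm_smul, Complex.norm_real, Real.norm_of_nonneg hρ] at h

theorem truncOp_mulCoord (ρ : ℝ) (f : Lp ℂ 2 μ) :
    truncOp μ ρ (mulCoord μ f) = mulCoord μ (truncOp μ ρ f) := mulOp_comm _ _ f

variable [IsFiniteMeasure μ]

/-- The witness is `z` restricted to `|z| > ρ`: its inner product with `conj z ^ n` is a radially
weighted integral of `z ^ (n + 1)`, which vanishes. -/
theorem IsRotInvariant.exists_mem_orthogonal_truncOp_eq_zero (hμ : IsRotInvariant μ) {ρ : ℝ}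
    (h0 : 0 ≤ ρ) (hpos : 0 < μ {z : Disc | ρ < ‖(z : ℂ)‖}) :
    ∃ f ∈ (conjP2 μ)ᗮ, f ≠ 0 ∧ truncOp μ ρ f = 0 := by
  set g := mulCoord μ (conjPow μ 0) with hg
  have hgae : g =ᵐ[μ] fun z : Disc => (z : ℂ) := by
    filter_upwards [mulCoord_coeFn μ (conjPow μ 0), conjPow_coeFn (μ := μ) 0] with z h1 h2
    rw [h1, h2, pow_zero, mul_one]
  refine ⟨g - truncOp μ ρ g, ?_, ?_, ?_⟩
  · have key : ∀ σ, truncOp μ σ g ∈ (conjP2 μ)ᗮ := by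
      intro σ
      rw [mem_conjP2_orthogonal_iff]
      intro n
      rw [inner_conjPow]
      refine (integral_congr_ae ?_).trans
        (hμ.integral_radial_mul_pow (discInd_rotDisc σ) (Nat.succ_ne_zero n))
      filter_upwards [hgae, truncOp_coeFn σ g] with z h1 h2
      rw [h2, h1, Nat.succ_eq_add_one]
      ring
    have h1 := key 1
    rw [truncOp_one] at h1
    exact Submodule.sub_mem _ h1 (key ρ)
  · intro h
    have h1 : ∀ᵐ z : Disc ∂μ, ¬ ρ < ‖(z : ℂ)‖ := by
      rw [sub_eq_zero] at h
      have h2 : g =ᵐ[μ] truncOp μ ρ g := by rw [← h]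
      filter_upwards [h2, hgae, truncOp_coeFn ρ g] with z h3 h4 h5 h6
      rw [h3, h5, discInd_of_lt h6, zero_mul] at h4
      rw [← h4, norm_zero] at h6
      exact h6.not_ge h0
    exact hpos.ne' (by simpa [ae_iff] using h1)
  · rw [map_sub, truncOp_truncOp le_rfl, sub_self]

theorem pow_mul_norm_le_norm_coordOp_pow {ρ : ℝ} (h0 : 0 ≤ ρ) {f : (conjP2 μ)ᗮ}
    (hf : truncOp μ ρ f = 0) (n : ℕ) :
    ρ ^ n * ‖f‖ ≤ ‖(coordOp μ ^ n) f‖ ∧ truncOp μ ρ ((coordOp μ ^ n) f : (conjP2 μ)ᗮ) = 0 := by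
  induction n with
  | zero => simpa using hf
  | succ n ih =>
    have h1 : (coordOp μ ^ (n + 1)) f = coordOp μ ((coordOp μ ^ n) f) := by
      rw [pow_succ']
      rfl
    rw [h1, coe_coordOp, truncOp_mulCoord, ih.2, map_zero]
    refine ⟨?_, rfl⟩
    calc ρ ^ (n + 1) * ‖f‖ = ρ * (ρ ^ n * ‖f‖) := by ring
      _ ≤ ρ * ‖(coordOp μ ^ n) f‖ := by gcongr; exact ih.1
      _ ≤ _ := norm_mulCoord_ge h0 ih.2

theorem IsRotInvariant.one_le_norm_coordOp_pow (hμ : IsRotInvariant μ)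
    (hpos : ∀ ρ < 1, 0 < μ {z : Disc | ρ < ‖(z : ℂ)‖}) (n : ℕ) : 1 ≤ ‖coordOp μ ^ n‖ := by
  have h : ∀ ρ ∈ Ico (0 : ℝ) 1, ρ ^ n ≤ ‖coordOp μ ^ n‖ := by
    intro ρ hρ
    obtain ⟨f, hf, hne, hfρ⟩ := hμ.exists_mem_orthogonal_truncOp_eq_zero hρ.1 (hpos ρ hρ.2)
    have h1 := (pow_mul_norm_le_norm_coordOp_pow hρ.1 (f := ⟨f, hf⟩) hfρ n).1
    have h2 := h1.trans ((coordOp μ ^ n).le_opNorm ⟨f, hf⟩)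
    exact le_of_mul_le_mul_right h2 (norm_pos_iff (a := f).2 hne)
  have hlim : Tendsto (fun ρ : ℝ => ρ ^ n) (𝓝[<] 1) (𝓝 (1 ^ n)) :=
    ((continuous_pow n).tendsto 1).mono_left nhdsWithin_le_nhds
  rw [one_pow] at hlim
  refine le_of_tendsto hlim ?_
  filter_upwards [Ico_mem_nhdsLT zero_lt_one] with ρ hρ using h ρ hρ

theorem IsRotInvariant.sphere_subset_spectrum (hμ : IsRotInvariant μ)
    (hpos : ∀ ρ < 1, 0 < μ {z : Disc | ρ < ‖(z : ℂ)‖}) :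
    Metric.sphere (0 : ℂ) 1 ⊆ spectrum ℂ (coordOp μ) := by
  have hnt : Nontrivial (conjP2 μ)ᗮ := by
    obtain ⟨f, hf, hne, -⟩ := hμ.exists_mem_orthogonal_truncOp_eq_zero le_rfl (hpos 0 one_pos)
    exact ⟨⟨⟨f, hf⟩, 0, fun h => hne (congrArg Subtype.val h)⟩⟩
  obtain ⟨z, hz, hz1⟩ :=
    exists_mem_spectrum_norm_eq_one norm_coordOp_le (hμ.one_le_norm_coordOp_pow hpos)
  intro w hw
  rw [mem_sphere_zero_iff_norm] at hw
  have hz0 : z ≠ 0 := norm_ne_zero_iff.1 (by rw [hz1]; exact one_ne_zero)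
  -- The spectrum is invariant under rotation, so the single point `z` on the circle is carried to
  -- `w`.
  let ξ : Circle := ⟨w / z, by simp [Submonoid.unitSphere, hw, hz1]⟩
  rw [(hμ.unitarilyEquivalent_smul ξ).spectrum_eq, spectrum.smul_eq_smul _ _ ⟨z, hz⟩]
  exact ⟨z, hz, div_mul_cancel₀ w hz0⟩

end Spectrum

end
noncomputable section

/-! ### Purity via Stone–Weierstrass -/

section Purity

/-- The inclusion of the disc in the closed unit disc. -/
def discIncl (z : Disc) : Metric.closedBall (0 : ℂ) 1 := ⟨z, Metric.ball_subset_closedBall z.2⟩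

theorem continuous_discIncl : Continuous discIncl := by
  unfold discIncl
  fun_prop

/-- The coordinate function on the closed unit disc. -/
def closedDiscCoord : C(Metric.closedBall (0 : ℂ) 1, ℂ) := ⟨Subtype.val, continuous_subtype_val⟩

theorem closure_adjoin_closedDiscCoord :
    (StarAlgebra.adjoin ℂ {closedDiscCoord}).topologicalClosure = ⊤ := by
  refine ContinuousMap.starSubalgebra_topologicalClosure_eq_top_of_separatesPoints _ ?_
  intro x y hxy
  exact ⟨closedDiscCoord, ⟨closedDiscCoord, StarAlgebra.self_mem_adjoin_singleton ℂ _, rfl⟩,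
    fun h => hxy (Subtype.ext h)⟩

variable {μ : Measure Disc}

theorem exists_mem_ae_eq_mul_of_mem_adjoin {M : Submodule ℂ (Lp ℂ 2 μ)}
    (h1 : ∀ f ∈ M, mulCoord μ f ∈ M) (h2 : ∀ f ∈ M, mulConjCoord μ f ∈ M)
    {p : C(Metric.closedBall (0 : ℂ) 1, ℂ)} (hp : p ∈ StarAlgebra.adjoin ℂ {closedDiscCoord}) :
    ∀ f ∈ M, ∃ g ∈ M, g =ᵐ[μ] fun z => p (discIncl z) * f z := by
  -- Carrying `p` and `star p` together makes the induction step for `star` a swap.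
  suffices h : (∀ f ∈ M, ∃ g ∈ M, g =ᵐ[μ] fun z => p (discIncl z) * f z) ∧
      (∀ f ∈ M, ∃ g ∈ M, g =ᵐ[μ] fun z => (star p) (discIncl z) * f z) from h.1
  have hadd : ∀ x y : C(Metric.closedBall (0 : ℂ) 1, ℂ),
      (∀ f ∈ M, ∃ g ∈ M, g =ᵐ[μ] fun z => x (discIncl z) * f z) →
      (∀ f ∈ M, ∃ g ∈ M, g =ᵐ[μ] fun z => y (discIncl z) * f z) →
      ∀ f ∈ M, ∃ g ∈ M, g =ᵐ[μ] fun z => (x + y) (discIncl z) * f z := by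
    intro x y hx hy f hf
    obtain ⟨g, hg, hgf⟩ := hx f hf
    obtain ⟨k, hk, hkf⟩ := hy f hf
    refine ⟨g + k, M.add_mem hg hk, ?_⟩
    filter_upwards [hgf, hkf, Lp.coeFn_add g k] with z h3 h4 h5
    rw [h5, Pi.add_apply, h3, h4, ContinuousMap.add_apply, add_mul]
  have hmul : ∀ x y : C(Metric.closedBall (0 : ℂ) 1, ℂ),
      (∀ f ∈ M, ∃ g ∈ M, g =ᵐ[μ] fun z => x (discIncl z) * f z) →
      (∀ f ∈ M, ∃ g ∈ M, g =ᵐ[μ] fun z => y (discIncl z) * f z) →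
      ∀ f ∈ M, ∃ g ∈ M, g =ᵐ[μ] fun z => (x * y) (discIncl z) * f z := by
    intro x y hx hy f hf
    obtain ⟨k, hk, hkf⟩ := hy f hf
    obtain ⟨g, hg, hgf⟩ := hx k hk
    refine ⟨g, hg, ?_⟩
    filter_upwards [hgf, hkf] with z h3 h4
    rw [h3, h4, ContinuousMap.mul_apply, mul_assoc]
  have hconst : ∀ (r : ℂ), ∀ f ∈ M, ∃ g ∈ M, g =ᵐ[μ] fun z =>
      (algebraMap ℂ C(Metric.closedBall (0 : ℂ) 1, ℂ) r) (discIncl z) * f z := by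
    intro r f hf
    refine ⟨r • f, M.smul_mem r hf, ?_⟩
    filter_upwards [Lp.coeFn_smul r f] with z h3
    rw [h3]
    rfl
  induction hp using StarAlgebra.adjoin_induction with
  | mem x hx =>
    rw [mem_singleton_iff] at hx
    subst hx
    exact ⟨fun f hf => ⟨_, h1 f hf, mulCoord_coeFn μ f⟩,
      fun f hf => ⟨_, h2 f hf, mulConjCoord_coeFn f⟩⟩
  | algebraMap r =>
    refine ⟨hconst r, ?_⟩
    rw [← algebraMap_star_comm]
    exact hconst (star r)
  | add x y _ _ hx hy =>
    refine ⟨hadd x y hx.1 hy.1, ?_⟩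
    rw [star_add]
    exact hadd _ _ hx.2 hy.2
  | mul x y _ _ hx hy =>
    refine ⟨hmul x y hx.1 hy.1, ?_⟩
    rw [star_mul]
    exact hmul _ _ hy.2 hx.2
  | star x _ hx =>
    refine ⟨hx.2, ?_⟩
    rw [star_star]
    exact hx.1

variable [IsFiniteMeasure μ]

theorem integrable_Lp_two (f : Lp ℂ 2 μ) : Integrable f μ :=
  (Lp.memLp f).integrable one_le_two

theorem integral_mul_eq_zero_of_forall_adjoin {f : Lp ℂ 2 μ}
    (h : ∀ p ∈ StarAlgebra.adjoin ℂ {closedDiscCoord}, ∫ z, p (discIncl z) * f z ∂μ = 0)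
    (p : C(Metric.closedBall (0 : ℂ) 1, ℂ)) : ∫ z, p (discIncl z) * f z ∂μ = 0 := by
  have hcont : Continuous fun p : C(Metric.closedBall (0 : ℂ) 1, ℂ) =>
      ∫ z, p (discIncl z) * f z ∂μ := by
    have hint := integrable_Lp_two f
    have hI : ∀ p : C(Metric.closedBall (0 : ℂ) 1, ℂ),
        Integrable (fun z => p (discIncl z) * f z) μ := fun p =>
      hint.bdd_mul (c := ‖p‖) (p.continuous.comp continuous_discIncl).aestronglyMeasurable
        (.of_forall fun z => p.norm_coe_le_norm _)
    -- The functional is Lipschitz in the sup norm with constant the `L¹` norm of `f`.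
    refine (LipschitzWith.of_dist_le_mul (K := (∫ z, ‖f z‖ ∂μ).toNNReal)
      fun p q => ?_).continuous
    rw [dist_eq_norm, dist_eq_norm, ← integral_sub (hI p) (hI q),
      Real.coe_toNNReal _ (integral_nonneg fun z => norm_nonneg _), mul_comm, ← integral_const_mul]
    refine norm_integral_le_of_norm_le (hint.norm.const_mul _) (.of_forall fun z => ?_)
    rw [← sub_mul, norm_mul]
    gcongr
    exact (p - q).norm_coe_le_norm (discIncl z)
  have hmem : p ∈ (StarAlgebra.adjoin ℂ {closedDiscCoord}).topologicalClosure := by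
    rw [closure_adjoin_closedDiscCoord]
    trivial
  exact closure_minimal
    (show (StarAlgebra.adjoin ℂ {closedDiscCoord} : Set C(Metric.closedBall (0 : ℂ) 1, ℂ)) ⊆
      {p | ∫ z, p (discIncl z) * f z ∂μ = 0} from h) (isClosed_singleton.preimage hcont) hmem

/-- Extending `f` by zero to the plane allows testing against smooth compactly supported functions,
whose restrictions to the closed disc are among the `p`. -/
theorem eq_zero_of_forall_integral_mul_eq_zero {f : Lp ℂ 2 μ}
    (h : ∀ p : C(Metric.closedBall (0 : ℂ) 1, ℂ), ∫ z, p (discIncl z) * f z ∂μ = 0) : f = 0 := by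
  have hemb : MeasurableEmbedding (Subtype.val : Disc → ℂ) :=
    MeasurableEmbedding.subtype_coe measurableSet_ball
  set F : ℂ → ℂ := Function.extend Subtype.val f 0 with hF
  have hFz : ∀ z : Disc, F z = f z := fun z => Subtype.val_injective.extend_apply _ _ z
  have hFi : Integrable F (μ.map Subtype.val) := by
    rw [hemb.integrable_map_iff]
    refine (integrable_Lp_two f).congr (.of_forall fun z => (hFz z).symm)
  have hF0 : ∀ᵐ z ∂(μ.map (Subtype.val : Disc → ℂ)), F z = 0 := by
    refine ae_eq_zero_of_integral_contDiff_smul_eq_zero hFi.locallyIntegrable fun g hg _ => ?_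
    rw [hemb.integral_map]
    have := h ⟨fun z => (g z : ℂ), by have := hg.continuous; fun_prop⟩
    simpa [hFz, discIncl] using this
  rw [hemb.ae_map_iff] at hF0
  apply Lp.ext
  filter_upwards [hF0, Lp.coeFn_zero ℂ 2 μ] with z h1 h2
  rw [h2, ← hFz, h1]
  rfl

theorem submodule_eq_bot_of_reducing {M : Submodule ℂ (Lp ℂ 2 μ)}
    (h1 : ∀ f ∈ M, mulCoord μ f ∈ M) (h2 : ∀ f ∈ M, mulConjCoord μ f ∈ M)
    (h3 : ∀ f ∈ M, inner ℂ (conjPow μ 0) f = 0) : M = ⊥ := by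
  rw [Submodule.eq_bot_iff]
  intro f hf
  refine eq_zero_of_forall_integral_mul_eq_zero (integral_mul_eq_zero_of_forall_adjoin ?_)
  intro p hp
  obtain ⟨g, hg, hgf⟩ := exists_mem_ae_eq_mul_of_mem_adjoin h1 h2 hp f hf
  rw [← integral_congr_ae hgf]
  have := h3 g hg
  rw [inner_conjPow] at this
  simpa using this

theorem norm_adjoint_apply_of_isStarNormal_restrict {H : Type*} [NormedAddCommGroup H]
    [InnerProductSpace ℂ H] [CompleteSpace H] {T : H →L[ℂ] H} {M : Submodule ℂ H}
    [CompleteSpace M] (hT : ∀ x ∈ M, T x ∈ M)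
    (hT' : ∀ x ∈ M, ContinuousLinearMap.adjoint T x ∈ M)
    (hn : IsStarNormal (T.restrict hT)) {x : H} (hx : x ∈ M) :
    ‖ContinuousLinearMap.adjoint T x‖ = ‖T x‖ := by
  have hadj : ContinuousLinearMap.adjoint (T.restrict hT) =
      (ContinuousLinearMap.adjoint T).restrict hT' := by
    symm
    rw [ContinuousLinearMap.eq_adjoint_iff]
    intro y z
    exact ContinuousLinearMap.adjoint_inner_left T (z : H) (y : H)
  have h := ContinuousLinearMap.isStarNormal_iff_norm_eq_adjoint.1 hn ⟨x, hx⟩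
  rw [hadj] at h
  exact h.symm

/-- `T* f` is the orthogonal projection of `conj z · f`. Since `‖conj z · f‖ = ‖z f‖ = ‖T f‖`, the
assumption says that projecting loses no norm, so the vector was already in the subspace. -/
theorem mulConjCoord_eq_adjoint_coordOp {f : (conjP2 μ)ᗮ}
    (hf : ‖ContinuousLinearMap.adjoint (coordOp μ) f‖ = ‖coordOp μ f‖) :
    mulConjCoord μ f = (ContinuousLinearMap.adjoint (coordOp μ) f : (conjP2 μ)ᗮ) := by
  set t := ContinuousLinearMap.adjoint (coordOp μ) f with ht
  have h1 : inner ℂ (mulConjCoord μ (f : Lp ℂ 2 μ)) (t : Lp ℂ 2 μ) = (‖t‖ : ℂ) ^ 2 := by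
    rw [← adjoint_mulCoord, ContinuousLinearMap.adjoint_inner_left]
    exact (ContinuousLinearMap.adjoint_inner_left (coordOp μ) t f).symm.trans
      (inner_self_eq_norm_sq_to_K t)
  have h2 : ‖mulConjCoord μ (f : Lp ℂ 2 μ)‖ = ‖t‖ := by
    rw [hf, ← adjoint_mulCoord]
    exact (ContinuousLinearMap.isStarNormal_iff_norm_eq_adjoint.1 isStarNormal_mulCoord _).symm
  have h3 : ‖mulConjCoord μ (f : Lp ℂ 2 μ) - (t : Lp ℂ 2 μ)‖ ^ 2 = 0 := by
    have h4 : RCLike.re ((‖t‖ : ℂ) ^ 2) = ‖t‖ ^ 2 := by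
      rw [← Complex.ofReal_pow]
      exact Complex.ofReal_re _
    rw [@norm_sub_sq ℂ, h1, h2, h4, Submodule.coe_norm]
    ring
  rw [← sub_eq_zero, ← norm_eq_zero]
  exact pow_eq_zero_iff two_ne_zero |>.1 h3

theorem isPure_coordOp : IsPure (coordOp μ) := by
  intro M _ hT hT' hn
  have h : M.map (conjP2 μ)ᗮ.subtype = ⊥ := by
    apply submodule_eq_bot_of_reducing
    · rintro _ ⟨f, hf, rfl⟩
      exact ⟨coordOp μ f, hT f hf, rfl⟩
    · rintro _ ⟨f, hf, rfl⟩
      exact ⟨_, hT' f hf, (mulConjCoord_eq_adjoint_coordOp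
        (norm_adjoint_apply_of_isStarNormal_restrict hT hT' hn hf)).symm⟩
    · rintro _ ⟨f, -, rfl⟩
      exact (mem_conjP2_orthogonal_iff μ _).1 f.2 0
  rw [Submodule.eq_bot_iff]
  intro f hf
  have hf0 : (conjP2 μ)ᗮ.subtype f ∈ (⊥ : Submodule ℂ (Lp ℂ 2 μ)) := h ▸ ⟨f, hf, rfl⟩
  exact Subtype.ext ((Submodule.mem_bot ℂ).1 hf0)

end Purity

/-! ### Closed span of conjugate powers versus conjugate analytic functions -/

section Conjugate_analytic

variable {μ : Measure Disc} [IsFiniteMeasure μ]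

/-- A subsequence of the partial sums converges almost everywhere to the `L²` sum, while all of them
converge pointwise to `G`. -/
theorem ae_eq_of_hasSum_conjPow {d : ℕ → ℂ} {p : Lp ℂ 2 μ} {G : Disc → ℂ}
    (hp : HasSum (fun n => d n • conjPow μ n) p)
    (hG : ∀ z : Disc, HasSum (fun n => d n * conj (z : ℂ) ^ n) (G z)) : p =ᵐ[μ] G := by
  obtain ⟨ns, hns, hlim⟩ :=
    (tendstoInMeasure_of_tendsto_Lp hp.tendsto_sum_nat).exists_seq_tendsto_ae
  have hsum : ∀ᵐ z ∂μ, ∀ N : ℕ, (∑ n ∈ Finset.range N, d n • conjPow μ n : Lp ℂ 2 μ) z =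
      ∑ n ∈ Finset.range N, d n * conj (z : ℂ) ^ n := by
    rw [ae_all_iff]
    intro N
    induction N with
    | zero =>
      filter_upwards [Lp.coeFn_zero ℂ 2 μ] with z hz
      simpa using hz
    | succ N ih =>
      simp only [Finset.sum_range_succ]
      filter_upwards [ih, Lp.coeFn_add (∑ n ∈ Finset.range N, d n • conjPow μ n)
        (d N • conjPow μ N), Lp.coeFn_smul (d N) (conjPow μ N), conjPow_coeFn (μ := μ) N]
        with z h1 h2 h3 h4
      rw [h2, Pi.add_apply, h1, h3, Pi.smul_apply, h4, smul_eq_mul]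
  filter_upwards [hlim, hsum] with z h1 h2
  simp only [h2] at h1
  exact tendsto_nhds_unique h1 ((hG z).tendsto_sum_nat.comp hns.tendsto_atTop)

theorem exists_pos_mul_pow_le_norm_conjPow {ρ : ℝ} (h0 : 0 ≤ ρ)
    (hpos : 0 < μ {z : Disc | ρ < ‖(z : ℂ)‖}) :
    ∃ c > 0, ∀ n, c * ρ ^ n ≤ ‖conjPow μ n‖ := by
  set f := conjPow μ 0 - truncOp μ ρ (conjPow μ 0) with hf
  have hfae : f =ᵐ[μ] fun z => 1 - discInd ρ z := by
    filter_upwards [Lp.coeFn_sub (conjPow μ 0) (truncOp μ ρ (conjPow μ 0)),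
      truncOp_coeFn ρ (conjPow μ 0), conjPow_coeFn (μ := μ) 0] with z h1 h2 h3
    rw [h1, Pi.sub_apply, h2, h3, pow_zero, mul_one]
  -- The constant is the norm of the indicator of `|z| > ρ`, where `|z| ^ n ≥ ρ ^ n`.
  refine ⟨‖f‖, ?_, fun n => ?_⟩
  · refine norm_pos_iff.2 fun hzero => ?_
    have h1 : ∀ᵐ z : Disc ∂μ, ¬ ρ < ‖(z : ℂ)‖ := by
      have h2 : f =ᵐ[μ] 0 := by rw [hzero]; exact Lp.coeFn_zero _ _ _
      filter_upwards [h2, hfae] with z h3 h4 h5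
      rw [h4, discInd_of_lt h5] at h3
      simp at h3
    exact hpos.ne' (by simpa [ae_iff] using h1)
  · have h : ‖(ρ : ℂ) ^ n • f‖ ≤ ‖conjPow μ n‖ := by
      refine Lp.norm_le_norm_of_ae_le ?_
      filter_upwards [Lp.coeFn_smul ((ρ : ℂ) ^ n) f, hfae, conjPow_coeFn (μ := μ) n]
        with z h1 h2 h3
      rw [h1, Pi.smul_apply, h2, h3, norm_smul, norm_pow, norm_pow, RCLike.norm_conj,
        Complex.norm_real, Real.norm_of_nonneg h0]
      rcases le_or_gt ‖(z : ℂ)‖ ρ with h | h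
      · rw [discInd_of_le h, sub_self, norm_zero, mul_zero]
        positivity
      · rw [discInd_of_lt h, sub_zero, norm_one, mul_one]
        gcongr
    rwa [norm_smul, norm_pow, Complex.norm_real, Real.norm_of_nonneg h0, mul_comm] at h

theorem exists_analyticOnNhd_hasSum_of_bound {a : ℕ → ℂ}
    (ha : ∀ ρ ∈ Ico (0 : ℝ) 1, ∃ C, ∀ n, ‖a n‖ * ρ ^ n ≤ C) :
    ∃ g : ℂ → ℂ, AnalyticOnNhd ℂ g (Metric.ball 0 1) ∧
      ∀ z ∈ Metric.ball (0 : ℂ) 1, HasSum (fun n => a n * z ^ n) (g z) := by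
  set p := FormalMultilinearSeries.ofScalars ℂ a with hp
  have hr : 1 ≤ p.radius := by
    refine ENNReal.le_of_forall_nnreal_lt fun r hr => ?_
    have hr1 : (r : ℝ) < 1 := by exact_mod_cast hr
    obtain ⟨C, hC⟩ := ha r ⟨r.2, hr1⟩
    refine p.le_radius_of_bound C fun n => ?_
    rw [hp, FormalMultilinearSeries.ofScalars_norm]
    exact hC n
  have hball : Metric.ball (0 : ℂ) 1 ⊆ Metric.eball 0 p.radius := by
    intro z hz
    have h1 : Metric.ball (0 : ℂ) 1 = Metric.eball 0 1 := by
      simpa using (Metric.eball_ofReal (x := (0 : ℂ)) (ε := 1)).symm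
    rw [h1] at hz
    exact Metric.eball_subset_eball hr hz
  refine ⟨p.sum, ((p.hasFPowerSeriesOnBall (zero_lt_one.trans_le hr)).analyticOnNhd).mono hball,
    fun z hz => ?_⟩
  simpa [hp, FormalMultilinearSeries.ofScalars_apply_eq, mul_comm] using p.hasSum (hball hz)

theorem isClosed_conjP2 : IsClosed (conjP2 μ : Set (Lp ℂ 2 μ)) :=
  Submodule.isClosed_topologicalClosure _

theorem IsRotInvariant.conjP2_subset_conjL2a (hμ : IsRotInvariant μ)
    (hpos : ∀ ρ < 1, 0 < μ {z : Disc | ρ < ‖(z : ℂ)‖}) :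
    (conjP2 μ : Set (Lp ℂ 2 μ)) ⊆ conjL2a μ := by
  intro p hp
  have h0 := conjPow_ne_zero (hpos 0 one_pos)
  have hs := hasSum_inner_div_smul_of_mem_closure
    (fun i j hij => hμ.inner_conjPow_conjPow hij) h0 hp
  set d : ℕ → ℂ := fun n => inner ℂ (conjPow μ n) p / (‖conjPow μ n‖ : ℂ) ^ 2 with hd
  have hdn : ∀ n, ‖d n‖ * ‖conjPow μ n‖ ≤ ‖p‖ := by
    intro n
    have hv : 0 < ‖conjPow μ n‖ := norm_pos_iff.2 (h0 n)
    have h1 := norm_inner_le_norm (𝕜 := ℂ) (conjPow μ n) p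
    rw [hd]
    simp only [norm_div, norm_pow, Complex.norm_real, norm_norm]
    rw [div_mul_eq_mul_div, div_le_iff₀ (by positivity)]
    nlinarith
  obtain ⟨g, hg, hgs⟩ := exists_analyticOnNhd_hasSum_of_bound (a := fun n => conj (d n)) (by
    intro ρ hρ
    obtain ⟨c, hc, hcn⟩ := exists_pos_mul_pow_le_norm_conjPow hρ.1 (hpos ρ hρ.2)
    refine ⟨‖p‖ / c, fun n => ?_⟩
    rw [le_div_iff₀ hc, RCLike.norm_conj]
    calc ‖d n‖ * ρ ^ n * c = ‖d n‖ * (c * ρ ^ n) := by ring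
      _ ≤ ‖d n‖ * ‖conjPow μ n‖ := by gcongr; exact hcn n
      _ ≤ ‖p‖ := hdn n)
  refine ⟨g, hg, ae_eq_of_hasSum_conjPow hs fun z => ?_⟩
  have := (hgs z z.2).map (starRingEnd ℂ) Complex.continuous_conj
  simpa [Function.comp_def] using this

/-- On `|z| ≤ ρ` the series is dominated by `∑ |a_k| ρ ^ k`, so it may be integrated term by term;
only the `n`-th term survives orthogonality. Without the cut-off this domination could fail. -/
theorem IsRotInvariant.inner_conjPow_truncOp_of_hasSum (hμ : IsRotInvariant μ)
    {a : ℕ → ℂ} {f : Lp ℂ 2 μ} {g : Disc → ℂ}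
    (hf : f =ᵐ[μ] fun z => conj (g z)) (hs : ∀ z : Disc, HasSum (fun n => a n * (z : ℂ) ^ n) (g z))
    {ρ : ℝ} (hρ : ρ ∈ Ico (0 : ℝ) 1) (n : ℕ) :
    inner ℂ (conjPow μ n) (truncOp μ ρ f) =
      conj (a n) * inner ℂ (conjPow μ n) (truncOp μ ρ (conjPow μ n)) := by
  set F : ℕ → Disc → ℂ := fun k z => (conj (a k) * (truncOp μ ρ (conjPow μ k) z)) * (z : ℂ) ^ n
    with hF
  have hFk : ∀ k, F k =ᵐ[μ] fun z => (conj (a k) * (discInd ρ z * conj (z : ℂ) ^ k)) * (z : ℂ) ^ n := by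
    intro k
    filter_upwards [truncOp_coeFn ρ (conjPow μ k), conjPow_coeFn (μ := μ) k] with z h1 h2
    simp only [hF]
    rw [h1, h2]
  have hint : ∀ k, Integrable (F k) μ := by
    intro k
    refine (((integrable_Lp_two (truncOp μ ρ (conjPow μ k))).const_mul (conj (a k))).mul_bdd
      (c := 1) ?_ (.of_forall fun z => ?_))
    · exact Continuous.aestronglyMeasurable (by fun_prop)
    · rw [norm_pow]
      exact pow_le_one₀ (norm_nonneg _) (norm_coe_disc_lt_one z).le
  have hbound : ∀ k, ∀ᵐ z ∂μ, ‖F k z‖ ≤ ‖a k‖ * ρ ^ k := by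
    intro k
    filter_upwards [hFk k] with z hz
    rw [hz, norm_mul, norm_mul, norm_mul, RCLike.norm_conj, norm_pow, norm_pow, RCLike.norm_conj]
    have h1 : ‖(z : ℂ)‖ ^ n ≤ 1 := pow_le_one₀ (norm_nonneg _) (norm_coe_disc_lt_one z).le
    have h2 : ‖discInd ρ z‖ * ‖(z : ℂ)‖ ^ k ≤ ρ ^ k := by
      rcases le_or_gt ‖(z : ℂ)‖ ρ with h | h
      · rw [discInd_of_le h, norm_one, one_mul]
        gcongr
      · rw [discInd_of_lt h, norm_zero, zero_mul]
        exact pow_nonneg hρ.1 k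
    calc _ ≤ ‖a k‖ * ρ ^ k * 1 := by gcongr; exact mul_nonneg (norm_nonneg _) (pow_nonneg hρ.1 k)
      _ = _ := mul_one _
  have hsummable : Summable fun k => ‖a k‖ * ρ ^ k := by
    have h := (hs ⟨ρ, by
      rw [mem_ball_zero_iff, Complex.norm_real, Real.norm_of_nonneg hρ.1]; exact hρ.2⟩).summable.norm
    simpa [norm_mul, norm_pow, abs_of_nonneg hρ.1] using h
  have hsum := hasSum_integral_of_summable_integral_norm hint (by
    refine Summable.of_nonneg_of_le (fun k => by positivity) (fun k => ?_)
      (hsummable.mul_right (μ.real univ))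
    calc ∫ z, ‖F k z‖ ∂μ ≤ ∫ _, ‖a k‖ * ρ ^ k ∂μ :=
          integral_mono_ae (hint k).norm (integrable_const _) (hbound k)
      _ = _ := by rw [integral_const, smul_eq_mul, mul_comm])
  have hFint : ∀ k, ∫ z, F k z ∂μ = conj (a k) * inner ℂ (conjPow μ n) (truncOp μ ρ (conjPow μ k)) := by
    intro k
    rw [inner_conjPow, ← integral_const_mul]
    refine integral_congr_ae (.of_forall fun z => ?_)
    simp only [hF]
    ring
  have hlim : ∫ z, ∑' k, F k z ∂μ = inner ℂ (conjPow μ n) (truncOp μ ρ f) := by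
    rw [inner_conjPow]
    refine integral_congr_ae ?_
    filter_upwards [ae_all_iff.2 hFk, truncOp_coeFn ρ f, hf] with z h1 h2 h3
    rw [h2, h3, tsum_congr h1]
    have h4 := (hs z).map (starRingEnd ℂ) Complex.continuous_conj
    have h5 := (h4.mul_left (discInd ρ z)).mul_right ((z : ℂ) ^ n)
    rw [← h5.tsum_eq]
    refine tsum_congr fun k => ?_
    simp only [Function.comp_apply, map_mul, map_pow]
    ring
  rw [hlim] at hsum
  refine hsum.unique ?_
  rw [← hFint n]
  refine hasSum_single n fun k hk => ?_
  rw [hFint, hμ.inner_conjPow_truncOp ρ hk.symm, mul_zero]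

theorem IsRotInvariant.conjL2a_subset_conjP2 (hμ : IsRotInvariant μ) (h0 : ∀ n, conjPow μ n ≠ 0) :
    conjL2a μ ⊆ (conjP2 μ : Set (Lp ℂ 2 μ)) := by
  rintro f ⟨g, hg, hf⟩
  set a : ℕ → ℂ := fun n => (n.factorial : ℂ)⁻¹ * iteratedDeriv n g 0 with ha
  have hs : ∀ z : Disc, HasSum (fun n => a n * (z : ℂ) ^ n) (g z) := by
    intro z
    have h := Complex.hasSum_taylorSeries_on_ball hg.differentiableOn z.2
    simp only [smul_eq_mul, sub_zero] at h
    have hfun : (fun n => a n * (z : ℂ) ^ n) =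
        fun n => (n.factorial : ℂ)⁻¹ * ((z : ℂ) ^ n * iteratedDeriv n g 0) := by
      ext n
      simp only [ha]
      ring
    rw [hfun]
    exact h
  have hcoef : ∀ n, inner ℂ (conjPow μ n) f = conj (a n) * inner ℂ (conjPow μ n) (conjPow μ n) := by
    intro n
    have hρ : Tendsto (fun m : ℕ => 1 - 1 / ((m : ℝ) + 1)) atTop (𝓝 1) := by
      simpa using (tendsto_one_div_add_atTop_nhds_zero_nat (𝕜 := ℝ)).const_sub 1
    refine tendsto_nhds_unique (tendsto_inner_truncOp hρ (conjPow μ n) f) ?_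
    refine ((tendsto_inner_truncOp hρ (conjPow μ n) (conjPow μ n)).const_mul (conj (a n))).congr
      fun m => ?_
    refine (hμ.inner_conjPow_truncOp_of_hasSum hf hs ⟨?_, ?_⟩ n).symm
    · rw [sub_nonneg, div_le_one (by positivity)]
      linarith [(Nat.cast_nonneg m : (0 : ℝ) ≤ m)]
    · have : 0 < 1 / ((m : ℝ) + 1) := by positivity
      linarith
  have : CompleteSpace (conjP2 μ) := isClosed_conjP2.completeSpace_coe
  -- The projection has the same inner products with the powers as `f`, hence expansion coefficients
  -- `conj (a n)`, and so sums to the same function.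
  set p := (conjP2 μ).orthogonalProjectionOnto f with hp
  have hsum := hasSum_inner_div_smul_of_mem_closure
    (fun i j hij => hμ.inner_conjPow_conjPow hij) h0 p.2
  have hd : ∀ n, inner ℂ (conjPow μ n) (p : Lp ℂ 2 μ) / (‖conjPow μ n‖ : ℂ) ^ 2 = conj (a n) := by
    intro n
    have hn : conjPow μ n ∈ conjP2 μ :=
      Submodule.le_topologicalClosure _ (Submodule.subset_span ⟨n, rfl⟩)
    have h1 : inner ℂ (conjPow μ n) (p : Lp ℂ 2 μ) = inner ℂ (conjPow μ n) f :=
      Submodule.inner_orthogonalProjectionOnto_eq_of_mem_left (⟨_, hn⟩ : conjP2 μ) f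
    have hne : (‖conjPow μ n‖ : ℂ) ^ 2 ≠ 0 :=
      pow_ne_zero 2 (Complex.ofReal_ne_zero.2 (norm_ne_zero_iff.2 (h0 n)))
    rw [h1, hcoef, inner_self_eq_norm_sq_to_K]
    exact mul_div_cancel_right₀ _ hne
  simp only [hd] at hsum
  have hpf : (p : Lp ℂ 2 μ) =ᵐ[μ] fun z => conj (g z) := by
    refine ae_eq_of_hasSum_conjPow hsum fun z => ?_
    simpa [Function.comp_def] using (hs z).map (starRingEnd ℂ) Complex.continuous_conj
  have hfp : f = p := Lp.ext (hf.trans hpf.symm)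
  rw [hfp]
  exact p.2

end Conjugate_analytic

end
noncomputable section

/-! ### Poisson integrals over circles and properties of the measure -/

section Poisson

/-- Normalized arc length as a measure on `ℝ/ℤ`. -/
local notation "𝔪" => AddCircle.haarAddCircle (T := 1)

theorem integral_toCircle_pow {n : ℕ} (hn : n ≠ 0) :
    ∫ t : UnitAddCircle, (AddCircle.toCircle t : ℂ) ^ n ∂𝔪 = 0 := by
  obtain ⟨ξ, hξ⟩ := exists_circle_pow_ne (j := n) (k := 0) hn
  obtain ⟨s, rfl⟩ := (AddCircle.homeomorphCircle (T := 1) one_ne_zero).surjective ξ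
  rw [AddCircle.homeomorphCircle_apply, pow_zero, mul_one] at hξ
  have h := integral_add_left_eq_self (μ := 𝔪)
    (fun t : UnitAddCircle => (AddCircle.toCircle t : ℂ) ^ n) s
  simp only [AddCircle.toCircle_add, Circle.coe_mul, mul_pow, integral_const_mul] at h
  have h2 : ((AddCircle.toCircle s : ℂ) ^ n - 1) *
      ∫ t : UnitAddCircle, (AddCircle.toCircle t : ℂ) ^ n ∂𝔪 = 0 := by
    rw [sub_mul, h, one_mul, sub_self]
  exact (mul_eq_zero.1 h2).resolve_left (sub_ne_zero.2 hξ)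

theorem continuous_coe_toCircle :
    Continuous fun t : UnitAddCircle => (AddCircle.toCircle t : ℂ) :=
  continuous_subtype_val.comp AddCircle.continuous_toCircle

theorem norm_mul_toCircle (q : ℂ) (t : UnitAddCircle) : ‖q * AddCircle.toCircle t‖ = ‖q‖ := by
  rw [norm_mul, Circle.norm_coe, mul_one]

theorem one_sub_mul_toCircle_ne_zero {q : ℂ} (hq : ‖q‖ < 1) (t : UnitAddCircle) :
    1 - q * AddCircle.toCircle t ≠ 0 := by
  intro h
  rw [sub_eq_zero] at h
  have := norm_mul_toCircle q t
  rw [← h, norm_one] at this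
  exact hq.ne this.symm

theorem integral_inv_one_sub_mul_toCircle {q : ℂ} (hq : ‖q‖ < 1) :
    ∫ t : UnitAddCircle, (1 - q * AddCircle.toCircle t)⁻¹ ∂𝔪 = 1 := by
  have hc := continuous_coe_toCircle
  have hint : ∀ n : ℕ, Integrable (fun t : UnitAddCircle => (q * AddCircle.toCircle t) ^ n) 𝔪 :=
    fun n => (Continuous.integrable_of_hasCompactSupport (by fun_prop)
      (HasCompactSupport.of_compactSpace _))
  have h := hasSum_integral_of_summable_integral_norm hint (by
    simp only [norm_pow, norm_mul_toCircle, integral_const, probReal_univ, one_smul]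
    exact summable_geometric_of_lt_one (norm_nonneg _) hq)
  have h1 : ∀ t : UnitAddCircle, ∑' n : ℕ, (q * AddCircle.toCircle t) ^ n =
      (1 - q * AddCircle.toCircle t)⁻¹ := fun t =>
    tsum_geometric_of_norm_lt_one (by rwa [norm_mul_toCircle])
  simp only [h1] at h
  refine h.unique ?_
  have h2 := hasSum_single
    (f := fun n : ℕ => ∫ t : UnitAddCircle, (q * AddCircle.toCircle t) ^ n ∂𝔪) 0 fun n hn => by
      simp only [mul_pow, integral_const_mul, integral_toCircle_pow hn, mul_zero]
  simpa using h2

theorem integral_inv_norm_one_sub_mul_toCircle_sq {q : ℂ} (hq : ‖q‖ < 1) :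
    ∫ t : UnitAddCircle, (‖1 - q * AddCircle.toCircle t‖ ^ 2)⁻¹ ∂𝔪 = (1 - ‖q‖ ^ 2)⁻¹ := by
  have hc := continuous_coe_toCircle
  have hq2 : 0 < 1 - ‖q‖ ^ 2 := by nlinarith [norm_nonneg q]
  have hcont : Continuous fun t : UnitAddCircle => (1 - q * (AddCircle.toCircle t : ℂ))⁻¹ :=
    Continuous.inv₀ (by fun_prop) (one_sub_mul_toCircle_ne_zero hq)
  have hint : Integrable (fun t : UnitAddCircle => (1 - q * (AddCircle.toCircle t : ℂ))⁻¹) 𝔪 :=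
    hcont.integrable_of_hasCompactSupport (HasCompactSupport.of_compactSpace _)
  -- The Poisson kernel identity `(1 - |u|²) / |1 - u|² = 2 Re (1 / (1 - u)) - 1` for `|u| < 1`.
  have hpt : ∀ t : UnitAddCircle, (‖1 - q * AddCircle.toCircle t‖ ^ 2)⁻¹ =
      (1 - ‖q‖ ^ 2)⁻¹ * (2 * ((1 - q * (AddCircle.toCircle t : ℂ))⁻¹).re - 1) := by
    intro t
    have hn := norm_mul_toCircle q t
    have hne := one_sub_mul_toCircle_ne_zero hq t
    set w := q * (AddCircle.toCircle t : ℂ)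
    have hpos : 0 < ‖1 - w‖ ^ 2 := by
      have := norm_pos_iff.2 hne
      positivity
    rw [Complex.inv_re, Complex.normSq_eq_norm_sq, eq_inv_mul_iff_mul_eq₀ hq2.ne', ← hn]
    field_simp
    rw [← Complex.normSq_eq_norm_sq, ← Complex.normSq_eq_norm_sq, Complex.normSq_apply,
      Complex.normSq_apply]
    simp
    ring
  have hre := integral_re (𝕜 := ℂ) hint
  rw [integral_inv_one_sub_mul_toCircle hq] at hre
  have hre' : ∫ t : UnitAddCircle, ((1 - q * (AddCircle.toCircle t : ℂ))⁻¹).re ∂𝔪 = 1 := by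
    simpa using hre
  have hrei : Integrable (fun t : UnitAddCircle => ((1 - q * (AddCircle.toCircle t : ℂ))⁻¹).re) 𝔪 :=
    hint.re
  simp only [hpt]
  rw [integral_const_mul, integral_sub (hrei.const_mul 2) (integrable_const _), integral_const_mul,
    hre']
  simp
  norm_num

theorem lintegral_inv_enorm_one_sub_mul_toCircle_sq {q : ℂ} (hq : ‖q‖ < 1) :
    ∫⁻ t : UnitAddCircle, (‖1 - q * AddCircle.toCircle t‖ₑ ^ 2)⁻¹ ∂𝔪 =
      ENNReal.ofReal (1 - ‖q‖ ^ 2)⁻¹ := by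
  have hc := continuous_coe_toCircle
  rw [← integral_inv_norm_one_sub_mul_toCircle_sq hq, ofReal_integral_eq_lintegral_ofReal]
  · refine lintegral_congr fun t => ?_
    have h : 0 < ‖1 - q * (AddCircle.toCircle t : ℂ)‖ :=
      norm_pos_iff.2 (one_sub_mul_toCircle_ne_zero hq t)
    rw [ENNReal.ofReal_inv_of_pos (by positivity), ENNReal.ofReal_pow h.le, ofReal_norm]
  · refine Continuous.integrable_of_hasCompactSupport ?_ (HasCompactSupport.of_compactSpace _)
    refine Continuous.inv₀ (by fun_prop) fun t => ?_
    exact pow_ne_zero 2 (norm_ne_zero_iff.2 (one_sub_mul_toCircle_ne_zero hq t))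
  · exact .of_forall fun t => by positivity

theorem lintegral_inv_enorm_mul_toCircle_sub_sq {r : ℝ} (hr : 0 ≤ r) {w : ℂ} (h : r ≠ ‖w‖) :
    ∫⁻ t : UnitAddCircle, (‖(r : ℂ) * AddCircle.toCircle t - w‖ₑ ^ 2)⁻¹ ∂𝔪 =
      (ENNReal.ofReal |r ^ 2 - ‖w‖ ^ 2|)⁻¹ := by
  -- Both cases scale to `|1 - qζ|`: take `c = |w|`, `q = r / w` if `r < |w|`, and `c = r`, `q =
  -- conj w / r` if `r > |w|`, after multiplying by the unimodular `conj ζ` and conjugating.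
  have key : ∀ (c : ℝ) (q : ℂ), 0 < c → ‖q‖ < 1 →
      (∀ t : UnitAddCircle, ‖(r : ℂ) * AddCircle.toCircle t - w‖ =
        c * ‖1 - q * AddCircle.toCircle t‖) → |r ^ 2 - ‖w‖ ^ 2| = c ^ 2 * (1 - ‖q‖ ^ 2) →
      ∫⁻ t : UnitAddCircle, (‖(r : ℂ) * AddCircle.toCircle t - w‖ₑ ^ 2)⁻¹ ∂𝔪 =
      (ENNReal.ofReal |r ^ 2 - ‖w‖ ^ 2|)⁻¹ := by
    intro c q hc hq hcq habs
    have hq2 : 0 < 1 - ‖q‖ ^ 2 := by nlinarith [norm_nonneg q]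
    have hc2 : ENNReal.ofReal (c ^ 2) ≠ 0 := by
      rw [Ne, ENNReal.ofReal_eq_zero, not_le]
      positivity
    have hpt : ∀ t : UnitAddCircle, (‖(r : ℂ) * AddCircle.toCircle t - w‖ₑ ^ 2)⁻¹ =
        (ENNReal.ofReal (c ^ 2))⁻¹ * (‖1 - q * AddCircle.toCircle t‖ₑ ^ 2)⁻¹ := by
      intro t
      rw [← ENNReal.mul_inv (.inl hc2) (.inl ENNReal.ofReal_ne_top), ← ofReal_norm, hcq t,
        ENNReal.ofReal_mul hc.le, mul_pow, ofReal_norm, ENNReal.ofReal_pow hc.le]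
    simp only [hpt]
    rw [lintegral_const_mul' _ _ (ENNReal.inv_ne_top.2 hc2),
      lintegral_inv_enorm_one_sub_mul_toCircle_sq hq, habs, ENNReal.ofReal_mul (by positivity),
      ENNReal.mul_inv (.inl hc2) (.inl ENNReal.ofReal_ne_top), ENNReal.ofReal_inv_of_pos hq2]
  rcases h.lt_or_gt with h | h
  · have hw : 0 < ‖w‖ := hr.trans_lt h
    have hw0 : w ≠ 0 := norm_pos_iff.1 hw
    have hq : ‖(r : ℂ) / w‖ = r / ‖w‖ := by
      rw [norm_div, Complex.norm_real, Real.norm_of_nonneg hr]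
    refine key ‖w‖ (r / w) hw ?_ (fun t => ?_) ?_
    · rw [hq, div_lt_one hw]
      exact h
    · rw [← norm_mul, norm_sub_rev]
      congr 1
      field_simp
    · rw [hq, abs_of_nonpos (by nlinarith)]
      field_simp
      ring
  · have hr0 : 0 < r := (norm_nonneg w).trans_lt h
    have hrc : (r : ℂ) ≠ 0 := Complex.ofReal_ne_zero.2 hr0.ne'
    have hq : ‖conj w / (r : ℂ)‖ = ‖w‖ / r := by
      rw [norm_div, Complex.norm_real, Real.norm_of_nonneg hr, RCLike.norm_conj]
    refine key r (conj w / r) hr0 ?_ (fun t => ?_) ?_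
    · rw [hq, div_lt_one hr0]
      exact h
    · have h1 : ‖(r : ℂ) * AddCircle.toCircle t - w‖ =
          ‖conj (AddCircle.toCircle t : ℂ) * ((r : ℂ) * AddCircle.toCircle t - w)‖ := by
        rw [norm_mul, RCLike.norm_conj, Circle.norm_coe, one_mul]
      have h2 : conj (AddCircle.toCircle t : ℂ) * ((r : ℂ) * AddCircle.toCircle t - w) =
          r * conj (1 - conj w / r * AddCircle.toCircle t) := by
        have h3 : (AddCircle.toCircle t : ℂ) * conj (AddCircle.toCircle t : ℂ) = 1 := by
          rw [Complex.mul_conj', Circle.norm_coe]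
          simp
        simp only [map_sub, map_one, map_mul, map_div₀, Complex.conj_conj, Complex.conj_ofReal]
        field_simp
        linear_combination (r : ℂ) * h3
      rw [h1, h2, norm_mul, RCLike.norm_conj, Complex.norm_real, Real.norm_of_nonneg hr]
    · rw [hq, abs_of_nonneg (by nlinarith [norm_nonneg w])]
      field_simp

/-- For `r < |w|`, moving a point of the circle of radius `|w|` inward to radius `r` gives `||w|ζ -
w| ≤ 2 |rζ - w|`. The integral thus exceeds a quarter of the value at radius `r`, which blows up as
`r → |w|`. -/
theorem lintegral_inv_enorm_mul_toCircle_sub_sq_eq_top {w : ℂ} (hw : w ≠ 0) :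
    ∫⁻ t : UnitAddCircle, (‖(‖w‖ : ℂ) * AddCircle.toCircle t - w‖ₑ ^ 2)⁻¹ ∂𝔪 = ∞ := by
  have hw' : 0 < ‖w‖ := norm_pos_iff.2 hw
  have hle : ∀ r ∈ Ioo 0 ‖w‖, (4 : ℝ≥0∞)⁻¹ * (ENNReal.ofReal |r ^ 2 - ‖w‖ ^ 2|)⁻¹ ≤
      ∫⁻ t : UnitAddCircle, (‖(‖w‖ : ℂ) * AddCircle.toCircle t - w‖ₑ ^ 2)⁻¹ ∂𝔪 := by
    intro r hr
    rw [← lintegral_inv_enorm_mul_toCircle_sub_sq hr.1.le hr.2.ne,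
      ← lintegral_const_mul' _ _ (by simp)]
    refine lintegral_mono fun t => ?_
    have h1 : ‖(‖w‖ : ℂ) * AddCircle.toCircle t - w‖ ≤ 2 * ‖(r : ℂ) * AddCircle.toCircle t - w‖ := by
      have h2 : ‖w‖ - r ≤ ‖(r : ℂ) * AddCircle.toCircle t - w‖ := by
        have := norm_sub_norm_le w ((r : ℂ) * AddCircle.toCircle t)
        rwa [norm_mul_toCircle, Complex.norm_real, Real.norm_of_nonneg hr.1.le, norm_sub_rev] at this
      have h3 : ‖((‖w‖ - r : ℝ) : ℂ) * AddCircle.toCircle t‖ = ‖w‖ - r := by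
        rw [norm_mul_toCircle, Complex.norm_real, Real.norm_of_nonneg (sub_nonneg.2 hr.2.le)]
      calc ‖(‖w‖ : ℂ) * AddCircle.toCircle t - w‖ =
          ‖((‖w‖ - r : ℝ) : ℂ) * AddCircle.toCircle t +
            ((r : ℂ) * AddCircle.toCircle t - w)‖ := by
            congr 1
            push_cast
            ring
        _ ≤ (‖w‖ - r) + ‖(r : ℂ) * AddCircle.toCircle t - w‖ :=
            (norm_add_le _ _).trans_eq (by rw [h3])
        _ ≤ _ := by linarith
    have h4 : ‖(‖w‖ : ℂ) * AddCircle.toCircle t - w‖ₑ ≤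
        2 * ‖(r : ℂ) * AddCircle.toCircle t - w‖ₑ := by
      rw [← ofReal_norm, ← ofReal_norm]
      refine (ENNReal.ofReal_le_ofReal h1).trans_eq ?_
      rw [ENNReal.ofReal_mul zero_le_two]
      simp
    rw [← ENNReal.mul_inv (by simp) (by simp), ENNReal.inv_le_inv]
    calc _ ≤ (2 * ‖(r : ℂ) * AddCircle.toCircle t - w‖ₑ) ^ 2 := by gcongr
      _ = _ := by rw [mul_pow]; norm_num
  have hlim : Tendsto (fun r : ℝ => (4 : ℝ≥0∞)⁻¹ * (ENNReal.ofReal |r ^ 2 - ‖w‖ ^ 2|)⁻¹)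
      (𝓝[<] ‖w‖) (𝓝 ∞) := by
    have h1 : Tendsto (fun r : ℝ => ENNReal.ofReal |r ^ 2 - ‖w‖ ^ 2|) (𝓝[<] ‖w‖) (𝓝 0) := by
      have hc : Continuous fun r : ℝ => ENNReal.ofReal |r ^ 2 - ‖w‖ ^ 2| :=
        ENNReal.continuous_ofReal.comp (by fun_prop)
      have := (hc.tendsto ‖w‖).mono_left (nhdsWithin_le_nhds (s := Iio ‖w‖))
      simpa using this
    have h2 := ENNReal.Tendsto.const_mul (a := (4 : ℝ≥0∞)⁻¹) (tendsto_inv_iff.2 h1)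
      (.inl (by simp))
    rw [ENNReal.inv_zero, ENNReal.mul_top (by simp)] at h2
    exact h2
  refine top_le_iff.1 (le_of_tendsto hlim ?_)
  filter_upwards [Ioo_mem_nhdsLT hw'] with r hr using hle r hr

theorem le_lintegral_inv_enorm_mul_toCircle_sub_sq {r : ℝ} (hr : 0 < r) (w : ℂ) :
    (ENNReal.ofReal |r ^ 2 - ‖w‖ ^ 2|)⁻¹ ≤
      ∫⁻ t : UnitAddCircle, (‖(r : ℂ) * AddCircle.toCircle t - w‖ₑ ^ 2)⁻¹ ∂𝔪 := by
  by_cases h : r = ‖w‖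
  · rw [h, lintegral_inv_enorm_mul_toCircle_sub_sq_eq_top (norm_pos_iff.1 (h ▸ hr))]
    exact le_top
  · exact (lintegral_inv_enorm_mul_toCircle_sub_sq hr.le h).ge

variable (ν : Measure (Ioo (0 : ℝ) 1))

theorem lintegral_rotMeasure {F : Disc → ℝ≥0∞} (hF : Measurable F) :
    ∫⁻ z, F z ∂(rotMeasure ν) = ∫⁻ r, ∫⁻ t, F (polarDisc (r, t)) ∂𝔪 ∂ν := by
  rw [rotMeasure, lintegral_map hF continuous_polarDisc.measurable]
  exact lintegral_prod _ (hF.comp continuous_polarDisc.measurable).aemeasurable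

theorem lintegral_inv_le_lintegral_rotMeasure (w : ℂ) :
    ∫⁻ r : Ioo (0 : ℝ) 1, (ENNReal.ofReal |(r : ℝ) ^ 2 - ‖w‖ ^ 2|)⁻¹ ∂ν ≤
      ∫⁻ z : Disc, (‖(z : ℂ) - w‖ₑ ^ 2)⁻¹ ∂(rotMeasure ν) := by
  rw [lintegral_rotMeasure ν (by fun_prop)]
  exact lintegral_mono fun r => le_lintegral_inv_enorm_mul_toCircle_sub_sq r.2.1 w

/-- Together with connectedness this rules out isolated points, so that Haar measure on the circle
has no atoms. -/
instance : Nontrivial UnitAddCircle := by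
  obtain ⟨ξ, hξ⟩ := exists_circle_pow_ne one_ne_zero
  have : Nontrivial Circle := ⟨ξ, 1, fun h => hξ (by simp [h])⟩
  exact (AddCircle.homeomorphCircle (T := 1) one_ne_zero).toEquiv.nontrivial

theorem rotMeasure_ae_ne (w : ℂ) : ∀ᵐ z : Disc ∂(rotMeasure ν), (z : ℂ) ≠ w := by
  have hm : MeasurableSet {z : Disc | (z : ℂ) = w} :=
    measurableSet_eq_fun (by fun_prop) (by fun_prop)
  have h0 : (rotMeasure ν) {z : Disc | (z : ℂ) = w} = 0 := by
    rw [← lintegral_indicator_one hm, lintegral_rotMeasure ν (measurable_one.indicator hm)]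
    refine (lintegral_congr fun r => ?_).trans lintegral_zero
    have hsub : {t : UnitAddCircle | ((polarDisc (r, t) : Disc) : ℂ) = w}.Subsingleton := by
      intro s hs t ht
      have hr : ((r : ℝ) : ℂ) ≠ 0 := Complex.ofReal_ne_zero.2 r.2.1.ne'
      refine AddCircle.injective_toCircle (T := 1) one_ne_zero (Subtype.ext ?_)
      exact mul_left_cancel₀ hr ((show _ = w from hs).trans (show _ = w from ht).symm)
    have h1 : 𝔪 {t : UnitAddCircle | ((polarDisc (r, t) : Disc) : ℂ) = w} = 0 :=
      hsub.measure_zero _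
    rw [← h1, ← lintegral_indicator_one]
    · rfl
    · exact hm.preimage (continuous_polarDisc.measurable.comp (by fun_prop))
  simpa [ae_iff] using h0

theorem rotMeasure_norm_gt_pos
    (hν : (1 : ℝ) ∈ (ν.map (Subtype.val : Ioo (0 : ℝ) 1 → ℝ)).support) {ρ : ℝ} (hρ : ρ < 1) :
    0 < rotMeasure ν {z : Disc | ρ < ‖(z : ℂ)‖} := by
  have h1 := (Measure.mem_support_iff_forall _).1 hν (Ioi ρ) (Ioi_mem_nhds hρ)
  rw [Measure.map_apply measurable_subtype_coe measurableSet_Ioi] at h1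
  have hm : MeasurableSet {z : Disc | ρ < ‖(z : ℂ)‖} :=
    measurableSet_lt (by fun_prop) (by fun_prop)
  rw [rotMeasure, Measure.map_apply continuous_polarDisc.measurable hm]
  have hpre : polarDisc ⁻¹' {z : Disc | ρ < ‖(z : ℂ)‖} =
      ((Subtype.val : Ioo (0 : ℝ) 1 → ℝ) ⁻¹' Ioi ρ) ×ˢ univ := by
    ext p
    simp only [mem_preimage, mem_ofPred_eq, polarDisc, norm_mul_toCircle, Complex.norm_real,
      Real.norm_of_nonneg p.1.2.1.le, mem_prod, mem_univ, and_true, mem_Ioi]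
  rw [hpre, Measure.prod_prod, measure_univ, mul_one]
  exact h1

end Poisson

/-! ### Eigenvalues of the adjoint -/

section Point_spectrum

variable {μ : Measure Disc}

/-- The quotient `g / (z - w)` is analytic in the disc: the singularity is removable if `w` is
inside, and there is none otherwise. -/
theorem mem_conjL2a_of_mul_sub {f : Lp ℂ 2 μ} {g : ℂ → ℂ} {w : ℂ}
    (hg : AnalyticOnNhd ℂ g (Metric.ball 0 1)) (hgw : ‖w‖ < 1 → g w = 0)
    (hne : ∀ᵐ z : Disc ∂μ, (z : ℂ) ≠ w)
    (hf : ∀ᵐ z : Disc ∂μ, conj (f z) * ((z : ℂ) - w) = g z) : f ∈ conjL2a μ := by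
  obtain ⟨k, hk, hkz⟩ : ∃ k : ℂ → ℂ, AnalyticOnNhd ℂ k (Metric.ball 0 1) ∧
      ∀ z ∈ Metric.ball (0 : ℂ) 1, z ≠ w → k z * (z - w) = g z := by
    by_cases hw : ‖w‖ < 1
    · have hball : Metric.ball (0 : ℂ) 1 ∈ 𝓝 w := Metric.isOpen_ball.mem_nhds (by simpa using hw)
      refine ⟨dslope g w, ((Complex.differentiableOn_dslope hball).2
        hg.differentiableOn).analyticOnNhd Metric.isOpen_ball, fun z _ hz => ?_⟩
      rw [dslope_of_ne _ hz, slope_def_field, div_mul_cancel₀ _ (sub_ne_zero.2 hz), hgw hw, sub_zero]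
    · refine ⟨fun z => g z / (z - w), hg.div (fun z _ => by fun_prop) fun z hz h => ?_,
        fun z _ hz => div_mul_cancel₀ _ (sub_ne_zero.2 hz)⟩
      rw [sub_eq_zero] at h
      rw [← h] at hw
      exact hw (by simpa using hz)
  refine ⟨k, hk, ?_⟩
  filter_upwards [hne, hf] with z hz hfz
  have h : conj (f z) = k z :=
    mul_right_cancel₀ (sub_ne_zero.2 hz) (hfz.trans (hkz z z.2 hz).symm)
  rw [← h, Complex.conj_conj]

variable [IsFiniteMeasure μ]

theorem mulConjCoord_sub_smul_mem_conjP2 {f : (conjP2 μ)ᗮ} {c : ℂ}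
    (hf : ContinuousLinearMap.adjoint (coordOp μ) f = c • f) :
    mulConjCoord μ f - c • (f : Lp ℂ 2 μ) ∈ conjP2 μ := by
  have : CompleteSpace (conjP2 μ) := isClosed_conjP2.completeSpace_coe
  suffices h : mulConjCoord μ f - c • (f : Lp ℂ 2 μ) ∈ (conjP2 μ)ᗮᗮ by
    rwa [Submodule.orthogonal_orthogonal] at h
  rw [Submodule.mem_orthogonal]
  intro h hh
  have h1 : inner ℂ (coordOp μ ⟨h, hh⟩) f = inner ℂ (⟨h, hh⟩ : (conjP2 μ)ᗮ) (c • f) := by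
    rw [← hf, ContinuousLinearMap.adjoint_inner_right]
  rw [inner_sub_right, sub_eq_zero, ← adjoint_mulCoord, ContinuousLinearMap.adjoint_inner_right]
  exact h1

theorem eq_zero_of_mem_conjL2a (hsub : conjL2a μ ⊆ (conjP2 μ : Set (Lp ℂ 2 μ)))
    {f : (conjP2 μ)ᗮ} (hf : (f : Lp ℂ 2 μ) ∈ conjL2a μ) : f = 0 := by
  have h := Submodule.inner_right_of_mem_orthogonal (hsub hf) f.2
  exact Subtype.ext (inner_self_eq_zero.1 h)

/-- Off `w`, `g(w) / (z - w)` is `conj f` minus the difference quotient of `g`. The first is square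
integrable and the second is bounded on `|z| ≤ R`; for `|z| > R` the kernel itself is bounded. -/
theorem lintegral_inv_enorm_sub_sq_lt_top {f : Lp ℂ 2 μ} {g : ℂ → ℂ} {w : ℂ}
    (hg : AnalyticOnNhd ℂ g (Metric.ball 0 1)) (hw : ‖w‖ < 1) (hgw : g w ≠ 0)
    (hne : ∀ᵐ z : Disc ∂μ, (z : ℂ) ≠ w)
    (hf : ∀ᵐ z : Disc ∂μ, conj (f z) * ((z : ℂ) - w) = g z) :
    ∫⁻ z : Disc, (‖(z : ℂ) - w‖ₑ ^ 2)⁻¹ ∂μ < ∞ := by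
  obtain ⟨R, hwR, hR⟩ := exists_between hw
  have hball : Metric.ball (0 : ℂ) 1 ∈ 𝓝 w := Metric.isOpen_ball.mem_nhds (by simpa using hw)
  have hk : ContinuousOn (dslope g w) (Metric.closedBall 0 R) :=
    (((Complex.differentiableOn_dslope hball).2 hg.differentiableOn).continuousOn).mono
      (Metric.closedBall_subset_ball hR)
  obtain ⟨C, hC⟩ := (isCompact_closedBall (0 : ℂ) R).exists_bound_of_continuousOn hk
  -- The two summands cover `|z| ≤ R`, through `(a + b)² ≤ 2a² + 2b²`, and `|z| > R`, where `|z - w|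
  -- ≥ R - |w|`.
  set D : ℝ := (2 * C ^ 2) / ‖g w‖ ^ 2 + ((R - ‖w‖) ^ 2)⁻¹ with hD
  have hint : Integrable (fun z => 2 / ‖g w‖ ^ 2 * ‖f z‖ ^ 2 + D) μ :=
    ((Lp.memLp f).integrable_norm_pow two_ne_zero |>.const_mul _).add (integrable_const _)
  have hgw' : 0 < ‖g w‖ := norm_pos_iff.2 hgw
  have hRw : 0 < R - ‖w‖ := sub_pos.2 hwR
  refine lt_of_le_of_lt (lintegral_mono_ae ?_) hint.lintegral_lt_top
  filter_upwards [hne, hf] with z hz hfz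
  have hzw : (z : ℂ) - w ≠ 0 := sub_ne_zero.2 hz
  have hzw' : 0 < ‖(z : ℂ) - w‖ := norm_pos_iff.2 hzw
  have hle : (‖(z : ℂ) - w‖ ^ 2)⁻¹ ≤ 2 / ‖g w‖ ^ 2 * ‖f z‖ ^ 2 + D := by
    rcases le_or_gt ‖(z : ℂ)‖ R with h | h
    · have h1 : g w = (conj (f z) - dslope g w z) * ((z : ℂ) - w) := by
        rw [sub_mul, hfz, dslope_of_ne _ hz, slope_def_field, div_mul_cancel₀ _ hzw]
        ring
      have h2 : ‖g w‖ ≤ (‖f z‖ + C) * ‖(z : ℂ) - w‖ := by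
        rw [h1, norm_mul]
        gcongr
        refine (norm_sub_le _ _).trans ?_
        rw [RCLike.norm_conj]
        gcongr
        exact hC z (by simpa using h)
      have h3 : ‖g w‖ ^ 2 ≤ (2 * ‖f z‖ ^ 2 + 2 * C ^ 2) * ‖(z : ℂ) - w‖ ^ 2 := by
        calc ‖g w‖ ^ 2 ≤ ((‖f z‖ + C) * ‖(z : ℂ) - w‖) ^ 2 := by gcongr
          _ = (‖f z‖ + C) ^ 2 * ‖(z : ℂ) - w‖ ^ 2 := by ring
          _ ≤ _ := by
            gcongr
            nlinarith [sq_nonneg (‖f z‖ - C)]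
      have h4 : (‖(z : ℂ) - w‖ ^ 2)⁻¹ ≤ (2 * ‖f z‖ ^ 2 + 2 * C ^ 2) / ‖g w‖ ^ 2 := by
        rw [le_div_iff₀ (by positivity), inv_mul_le_iff₀ (by positivity), mul_comm]
        exact h3
      refine h4.trans ?_
      have h5 : 0 ≤ ((R - ‖w‖) ^ 2)⁻¹ := by positivity
      rw [hD, add_div]
      have h6 : 2 * ‖f z‖ ^ 2 / ‖g w‖ ^ 2 = 2 / ‖g w‖ ^ 2 * ‖f z‖ ^ 2 := by ring
      linarith
    · have h1 : R - ‖w‖ ≤ ‖(z : ℂ) - w‖ := by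
        have := norm_sub_norm_le (z : ℂ) w
        linarith
      have h2 : (‖(z : ℂ) - w‖ ^ 2)⁻¹ ≤ ((R - ‖w‖) ^ 2)⁻¹ := by gcongr
      have h3 : 0 ≤ 2 / ‖g w‖ ^ 2 * ‖f z‖ ^ 2 := by positivity
      have h4 : 0 ≤ 2 * C ^ 2 / ‖g w‖ ^ 2 := by positivity
      linarith
  calc (‖(z : ℂ) - w‖ₑ ^ 2)⁻¹ = ENNReal.ofReal (‖(z : ℂ) - w‖ ^ 2)⁻¹ := by
        rw [ENNReal.ofReal_inv_of_pos (by positivity), ENNReal.ofReal_pow hzw'.le, ofReal_norm]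
    _ ≤ _ := ENNReal.ofReal_le_ofReal hle

theorem pointSpectrum_adjoint_coordOp_eq_empty
    (heq : (conjP2 μ : Set (Lp ℂ 2 μ)) = conjL2a μ)
    (hne : ∀ w : ℂ, ∀ᵐ z : Disc ∂μ, (z : ℂ) ≠ w)
    (htop : ∀ w : ℂ, ‖w‖ < 1 → ∫⁻ z : Disc, (‖(z : ℂ) - w‖ₑ ^ 2)⁻¹ ∂μ = ∞) :
    pointSpectrum (ContinuousLinearMap.adjoint (coordOp μ)) = ∅ := by
  rw [eq_empty_iff_forall_notMem]
  intro c hc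
  obtain ⟨f, hf, hf0⟩ := Module.End.HasEigenvalue.exists_hasEigenvector hc
  rw [Module.End.mem_eigenspace_iff] at hf
  refine hf0 (eq_zero_of_mem_conjL2a heq.ge ?_)
  have hmem := mulConjCoord_sub_smul_mem_conjP2 hf
  rw [← SetLike.mem_coe, heq] at hmem
  obtain ⟨g, hg, hgf⟩ := hmem
  have hfg : ∀ᵐ z : Disc ∂μ, conj ((f : Lp ℂ 2 μ) z) * ((z : ℂ) - conj c) = g z := by
    filter_upwards [hgf, Lp.coeFn_sub (mulConjCoord μ (f : Lp ℂ 2 μ)) (c • (f : Lp ℂ 2 μ)),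
      mulConjCoord_coeFn (f : Lp ℂ 2 μ), Lp.coeFn_smul c (f : Lp ℂ 2 μ)] with z h1 h2 h3 h4
    rw [h2, Pi.sub_apply, h3, h4, Pi.smul_apply, smul_eq_mul] at h1
    rw [← Complex.conj_conj (g z), ← h1]
    simp only [map_sub, map_mul, Complex.conj_conj]
    ring
  -- An eigenvector that is conjugate analytic is orthogonal to itself. The only obstruction to
  -- analyticity is `g (conj c) ≠ 0`, which the divergent integral excludes.
  refine mem_conjL2a_of_mul_sub hg (fun hw => ?_) (hne _) hfg
  by_contra hgw
  exact (lintegral_inv_enorm_sub_sq_lt_top hg hw hgw (hne _) hfg).ne (htop _ hw)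

end Point_spectrum

end

theorem mainTheorem3 (ν : Measure (Ioo (0 : ℝ) 1)) [IsFiniteMeasure ν]
    (hν : (1 : ℝ) ∈ (ν.map (Subtype.val : Ioo (0 : ℝ) 1 → ℝ)).support) :
    (conjP2 (rotMeasure ν) : Set (Lp ℂ 2 (rotMeasure ν))) = conjL2a (rotMeasure ν) ∧
    ‖coordOp (rotMeasure ν)‖ ≤ 1 ∧
    IsSubnormal (coordOp (rotMeasure ν)) ∧
    IsPure (coordOp (rotMeasure ν)) ∧
    HasDiscSpectrumExhaustion (coordOp (rotMeasure ν)) ∧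
    Metric.sphere (0 : ℂ) 1 ⊆ spectrum ℂ (coordOp (rotMeasure ν)) ∧
    (∀ ξ : ℂ, ‖ξ‖ = 1 →
      UnitarilyEquivalent (coordOp (rotMeasure ν)) (ξ • coordOp (rotMeasure ν))) ∧
    ((∀ a ∈ Ico (0 : ℝ) 1,
        ∫⁻ r : Ioo (0 : ℝ) 1, (ENNReal.ofReal |(r : ℝ) ^ 2 - a ^ 2|)⁻¹ ∂ν = ∞) →
      pointSpectrum (ContinuousLinearMap.adjoint (coordOp (rotMeasure ν))) = ∅) := by
  have hμ := isRotInvariant_rotMeasure ν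
  have hpos : ∀ ρ < 1, 0 < rotMeasure ν {z : Disc | ρ < ‖(z : ℂ)‖} :=
    fun ρ hρ => rotMeasure_norm_gt_pos ν hν hρ
  have h0 := conjPow_ne_zero (hpos 0 one_pos)
  have heq := (hμ.conjP2_subset_conjL2a hpos).antisymm (hμ.conjL2a_subset_conjP2 h0)
  refine ⟨heq, norm_coordOp_le, isSubnormal_coordOp, isPure_coordOp,
    hμ.hasDiscSpectrumExhaustion h0, hμ.sphere_subset_spectrum hpos, fun ξ hξ => ?_, fun htop => ?_⟩
  · exact hμ.unitarilyEquivalent_smul ⟨ξ, mem_sphere_zero_iff_norm.2 hξ⟩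
  · refine pointSpectrum_adjoint_coordOp_eq_empty heq (rotMeasure_ae_ne ν) fun w hw => ?_
    exact top_le_iff.1 ((htop ‖w‖ ⟨norm_nonneg w, hw⟩).ge.trans
      (lintegral_inv_le_lintegral_rotMeasure ν w))
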